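/- Let $n\ge 0$ be an even integer and let $W=\mathbb C^n$. A Latin square of size $n$ is an $n\times n$ matrix each of whose rows and each of whose columns contains every element of $\{1,\dots,n\}$ exactly once; each row and each column is thus a permutation of $\{1,\dots,n\}$, and the sign of the Latin square is the product of the signs of these $2n$ permutations. Let $\hat{Ch}_n(W)=\{w_1\cdots w_n \mid w_1,\dots,w_n\in W\}\subset S^nW$ be the affine cone over the Chow variety $Ch_n(W)\subset\mathbb P S^nW$, and let $\mathbb C[Ch_n(W)]$ be its coordinate ring, i.e. the algebra of restrictions to $\hat{Ch}_n(W)$ of polynomial functions on $S^nW$. The group $GL_n=GL(W)$ acts on it by $(g\cdot f)(p)=f(g^{-1}p)$. For a partition $\pi$, let $S_\pi$ denote the Schur functor (the image of the Young symmetrizer of $\pi$ on the $|\pi|$-th tensor power). Since functions on $S^nW$ form $Sym(S^nW^*)$, the module denoted $S_\pi\mathbb C^n$ in statements about $\mathbb C[Ch_n(\mathbb C^n)]$ is taken to be $S_\pi(W^*)$; for $\pi=(n^n)=(n,\dots,n)$ ($n$ parts) it is the one-dimensional $GL_n$-module on which $SL_n$ acts trivially and $g$ acts by $\det(g)^{-n}$.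 Let $\operatorname{perm}_n$ and $\det_n$ be the permanent and the determinant of $n\times n$ matrices, let $x^i_j$ ($1\le i,j\le n$) be coordinates on $\mathbb C^{n^2}$ and $y^i_j$ the dual coordinates. For polynomials $P(y)$ and $Q(x)$, homogeneous of the same degree, let $\langle P(y),Q(x)\rangle\in\mathbb C$ be the number obtained by applying to $Q$ the differential operator $P(\partial/\partial x)$, in which $y^i_j$ acts as $\partial/\partial x^i_j$. Let $\mu$ be a Haar measure on $SU(n)$. Then the following are equivalent: 1. (The Alon–Tarsi conjecture for $n$.) The number of Latin squares of size $n$ of sign $-1$ is not equal to the number of those of sign $+1$. 2. (Kumar's conjecture for $n$ with $i=n$.) The $GL_n$-module $S_{n^n}(W^*)$ occurs in $\mathbb C[Ch_n(W)]$, i.e. there is an injective $GL_n$-equivariant linear map $S_{n^n}(W^*)\to\mathbb C[Ch_n(W)]$. 3. $\int_{SU(n)}(\operatorname{perm}_n(g))^n\,d\mu(g)\ne 0$. 4. $\langle(\operatorname{perm}_n(y))^n,(\det_n(x))^n\rangle\ne 0$. Moreover, the following two statements are equivalent to each other: (i) $\int_{SU(n)}\prod_{1\le i,j\le n}g^i_j\,d\mu(g)\ne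 0$; (ii) $\big\langle\prod_{1\le i,j\le n}y^i_j,(\det_n(x))^n\big\rangle\ne 0$; and if they hold, then so do 1, 2, 3 and 4. -/

import Mathlib

open scoped TensorProduct

/-! ### Latin squares -/

/-- An `n × n` matrix with entries in `Fin n` (standing for `{1, …, n}`) each of whose rows and
columns contains every symbol exactly once. -/
@[ext]
structure LatinSquare (n : ℕ) where
  entry : Fin n → Fin n → Fin n
  row_bijective : ∀ i, Function.Bijective (fun j => entry i j)
  col_bijective : ∀ j, Function.Bijective (fun i => entry i j)

namespace LatinSquare

/-- The permutation `j ↦ L i j` read off from the `i`-th row. -/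
noncomputable def rowPerm {n : ℕ} (L : LatinSquare n) (i : Fin n) : Equiv.Perm (Fin n) :=
  Equiv.ofBijective _ (L.row_bijective i)

/-- The permutation `i ↦ L i j` read off from the `j`-th column. -/
noncomputable def colPerm {n : ℕ} (L : LatinSquare n) (j : Fin n) : Equiv.Perm (Fin n) :=
  Equiv.ofBijective _ (L.col_bijective j)

/-- The sign of a Latin square: the product of the signs of all its rows and columns. -/
noncomputable def sign {n : ℕ} (L : LatinSquare n) : ℤˣ :=
  (∏ i, Equiv.Perm.sign (L.rowPerm i)) * ∏ j, Equiv.Perm.sign (L.colPerm j)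

instance {n : ℕ} : Finite (LatinSquare n) :=
  Finite.of_injective LatinSquare.entry fun _ _ h => LatinSquare.ext h

end LatinSquare

/-- The Alon–Tarsi conjecture for a given `n` (the statement for this single value of `n`). -/
def AlonTarsi (n : ℕ) : Prop :=
  Nat.card {L : LatinSquare n // L.sign = -1} ≠ Nat.card {L : LatinSquare n // L.sign = 1}

/-! ### Schur modules -/

namespace YoungDiagram

/-- The Young diagram of the partition `(n^i) = (n, …, n)`: `i` rows of length `n`. -/
def rectangle (i n : ℕ) : YoungDiagram where
  cells := Finset.range i ×ˢ Finset.range n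
  isLowerSet := by
    rintro ⟨a, b⟩ ⟨c, d⟩ h hab
    have h' : c ≤ a ∧ d ≤ b := h
    simp only [Finset.coe_product, Finset.coe_range, Set.mem_prod, Set.mem_Iio] at hab ⊢
    omega

/-- The permutations of the boxes of `μ` that preserve each row. -/
def rowStabilizer (μ : YoungDiagram) : Set (Equiv.Perm μ.cells) :=
  {σ | ∀ c, (σ c).1.1 = c.1.1}

/-- The permutations of the boxes of `μ` that preserve each column. -/
def colStabilizer (μ : YoungDiagram) : Set (Equiv.Perm μ.cells) :=
  {σ | ∀ c, (σ c).1.2 = c.1.2}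

variable (μ : YoungDiagram) (V : Type*) [AddCommGroup V] [Module ℂ V]

/-- `V^{⊗ |μ|}`, with the tensor factors indexed by the boxes of `μ`. -/
abbrev TensorPow : Type _ := ⨂[ℂ] _ : μ.cells, V

/-- The action of a permutation of the boxes on `V^{⊗ |μ|}` by permuting the factors. -/
noncomputable def permAct (σ : Equiv.Perm μ.cells) : μ.TensorPow V →ₗ[ℂ] μ.TensorPow V :=
  (PiTensorProduct.reindex ℂ (fun _ : μ.cells => V) σ).toLinearMap

open scoped Classical in
/-- The row symmetrizer. -/
noncomputable def rowSymmetrizer : μ.TensorPow V →ₗ[ℂ] μ.TensorPow V :=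
  ∑ σ : Equiv.Perm μ.cells with σ ∈ μ.rowStabilizer, μ.permAct V σ

open scoped Classical in
/-- The column antisymmetrizer. -/
noncomputable def colAntisymmetrizer : μ.TensorPow V →ₗ[ℂ] μ.TensorPow V :=
  ∑ σ : Equiv.Perm μ.cells with σ ∈ μ.colStabilizer,
    ((Equiv.Perm.sign σ : ℤ) : ℂ) • μ.permAct V σ

/-- The Young symmetrizer of the diagram `μ`, acting on `V^{⊗ |μ|}`. -/
noncomputable def youngSymmetrizer : μ.TensorPow V →ₗ[ℂ] μ.TensorPow V :=
  μ.rowSymmetrizer V ∘ₗ μ.colAntisymmetrizer V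

/-- The Schur module `S_μ V`: the image of the Young symmetrizer in `V^{⊗ |μ|}`. -/
noncomputable def schurModule : Submodule ℂ (μ.TensorPow V) :=
  LinearMap.range (μ.youngSymmetrizer V)

variable {V} {G : Type*} [Group G] (ρ : Representation ℂ G V)

/-- The diagonal action of `G` on `V^{⊗ |μ|}`. -/
noncomputable def tensorRep : Representation ℂ G (μ.TensorPow V) where
  toFun g := PiTensorProduct.map fun _ => ρ g
  map_one' := by
    simp only [map_one]
    exact PiTensorProduct.map_one
  map_mul' g h := by
    simp only [map_mul]
    exact PiTensorProduct.map_mul (fun _ => ρ g) (fun _ => ρ h)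

theorem tensorRep_permAct (g : G) (σ : Equiv.Perm μ.cells) (x : μ.TensorPow V) :
    μ.tensorRep ρ g (μ.permAct V σ x) = μ.permAct V σ (μ.tensorRep ρ g x) :=
  PiTensorProduct.map_reindex (R := ℂ) (fun _ : μ.cells => ρ g) σ x

theorem tensorRep_youngSymmetrizer (g : G) (x : μ.TensorPow V) :
    μ.tensorRep ρ g (μ.youngSymmetrizer V x) = μ.youngSymmetrizer V (μ.tensorRep ρ g x) := by
  simp [youngSymmetrizer, rowSymmetrizer, colAntisymmetrizer, tensorRep_permAct]

/-- The action of `G` on the Schur module `S_μ V`. -/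
noncomputable def schurRep : Representation ℂ G (μ.schurModule V) :=
  (μ.tensorRep ρ).subrepresentation (μ.schurModule V) <| by
    rintro g _ ⟨x, rfl⟩
    exact ⟨_, (μ.tensorRep_youngSymmetrizer ρ g x).symm⟩

end YoungDiagram

/-- The defining representation of `GL_m(ℂ)` on `ℂ^m`. -/
noncomputable def stdRep (m : ℕ) : Representation ℂ (GL (Fin m) ℂ) (Fin m → ℂ) where
  toFun g := Matrix.toLin' (g : Matrix (Fin m) (Fin m) ℂ)
  map_one' := Matrix.toLin'_one
  map_mul' _ _ := Matrix.toLin'_mul _ _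

/-! ### The Chow variety

The symmetric algebra of `W = ℂ^m` is the polynomial ring in `m` variables, the variables being the
standard basis vectors of `W`; `S^d W` is its homogeneous part of degree `d`. -/

namespace Chow

open MvPolynomial

/-- The symmetric power `S^d (ℂ^m)`. -/
abbrev SymPow (m d : ℕ) : Submodule ℂ (MvPolynomial (Fin m) ℂ) :=
  homogeneousSubmodule (Fin m) ℂ d

/-- A vector of `ℂ^m` as an element of the symmetric algebra. -/
noncomputable def vec {m : ℕ} (w : Fin m → ℂ) : MvPolynomial (Fin m) ℂ := ∑ i, C (w i) * X i

/-- The algebra map of the symmetric algebra induced by a linear map of `ℂ^m`: the `j`-th basis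
vector is sent to the `j`-th column of `A`. -/
noncomputable def symAlgMap {m : ℕ} (A : Matrix (Fin m) (Fin m) ℂ) :
    MvPolynomial (Fin m) ℂ →ₐ[ℂ] MvPolynomial (Fin m) ℂ :=
  aeval fun j => vec fun i => A i j

theorem symAlgMap_vec {m : ℕ} (A : Matrix (Fin m) (Fin m) ℂ) (w : Fin m → ℂ) :
    symAlgMap A (vec w) = vec (A.mulVec w) := by
  simp only [symAlgMap, vec, map_sum, map_mul, aeval_X, algHom_C, algebraMap_eq, Matrix.mulVec,
    dotProduct, Finset.mul_sum, Finset.sum_mul]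
  rw [Finset.sum_comm]
  refine Finset.sum_congr rfl fun i _ => Finset.sum_congr rfl fun j _ => ?_
  ring

theorem symAlgMap_one {m : ℕ} : symAlgMap (1 : Matrix (Fin m) (Fin m) ℂ) = AlgHom.id ℂ _ := by
  ext1 j
  simp [symAlgMap, vec, Matrix.one_apply]

theorem symAlgMap_mul {m : ℕ} (A B : Matrix (Fin m) (Fin m) ℂ) :
    symAlgMap (A * B) = (symAlgMap A).comp (symAlgMap B) := by
  ext1 j
  have h : symAlgMap B (X j) = vec fun i => B i j := by simp [symAlgMap]
  rw [AlgHom.comp_apply, h, symAlgMap_vec]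
  simp only [symAlgMap, aeval_X]
  rfl

/-- The action of `GL_m(ℂ)` on `S^d (ℂ^m)`. -/
noncomputable def symRep (m d : ℕ) : Representation ℂ (GL (Fin m) ℂ) (SymPow m d) where
  toFun g := ((symAlgMap (g : Matrix (Fin m) (Fin m) ℂ)).toLinearMap).restrict <| by
    intro p hp
    have hv : ∀ j, (vec fun i => (g : Matrix (Fin m) (Fin m) ℂ) i j).IsHomogeneous 1 := fun j =>
      IsHomogeneous.sum _ _ _ fun i _ => isHomogeneous_C_mul_X _ i
    have h := IsHomogeneous.aeval (S := ℂ) hp _ hv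
    rw [one_mul] at h
    exact h
  map_one' := by
    ext1 p
    apply Subtype.ext
    simp [LinearMap.restrict_apply, symAlgMap_one]
  map_mul' g h := by
    ext1 p
    apply Subtype.ext
    simp only [Units.val_mul, symAlgMap_mul]
    rfl

/-- The affine cone over the Chow variety `Ch_d(ℂ^m) ⊆ ℙ S^d(ℂ^m)`:
all products `w_1 ⋯ w_d` of `d` vectors of `ℂ^m`. -/
def cone (m d : ℕ) : Set (SymPow m d) :=
  {p | ∃ w : Fin d → Fin m → ℂ, (p : MvPolynomial (Fin m) ℂ) = ∏ k, vec (w k)}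

theorem symRep_mem_cone {m d : ℕ} (g : GL (Fin m) ℂ) {p : SymPow m d} (hp : p ∈ cone m d) :
    symRep m d g p ∈ cone m d := by
  obtain ⟨w, hw⟩ := hp
  refine ⟨fun k => (g : Matrix (Fin m) (Fin m) ℂ).mulVec (w k), ?_⟩
  change symAlgMap (g : Matrix (Fin m) (Fin m) ℂ) (p : MvPolynomial (Fin m) ℂ) = _
  simp [hw, map_prod, symAlgMap_vec]

/-- The action of `GL_m(ℂ)` on all functions on the cone, `(g • f)(p) = f (g⁻¹ p)`. -/
noncomputable def functionRep (m d : ℕ) :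
    Representation ℂ (GL (Fin m) ℂ) (cone m d → ℂ) where
  toFun g := LinearMap.funLeft ℂ ℂ fun p : cone m d =>
    (⟨symRep m d g⁻¹ p, symRep_mem_cone g⁻¹ p.2⟩ : cone m d)
  map_one' := by
    ext f p
    simp [LinearMap.funLeft_apply]
  map_mul' g h := by
    ext f p
    simp [LinearMap.funLeft_apply, map_mul]

/-- The coordinate ring `ℂ[Ch_d(ℂ^m)]`: the algebra of restrictions to the cone of polynomial
functions on `S^d(ℂ^m)`, that is, the algebra generated by the restrictions of linear forms. -/
noncomputable def coordRing (m d : ℕ) : Subalgebra ℂ (cone m d → ℂ) :=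
  Algebra.adjoin ℂ (Set.range fun (φ : Module.Dual ℂ (SymPow m d)) (p : cone m d) => φ p)

theorem functionRep_mem_coordRing {m d : ℕ} (g : GL (Fin m) ℂ) {f : cone m d → ℂ}
    (hf : f ∈ coordRing m d) : functionRep m d g f ∈ coordRing m d := by
  induction hf using Algebra.adjoin_induction with
  | mem f hf =>
    obtain ⟨φ, rfl⟩ := hf
    exact Algebra.subset_adjoin ⟨φ ∘ₗ symRep m d g⁻¹, rfl⟩
  | algebraMap r => exact (coordRing m d).algebraMap_mem r
  | add f f' _ _ h h' => exact (coordRing m d).add_mem h h'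
  | mul f f' _ _ h h' => exact (coordRing m d).mul_mem h h'

/-- The coordinate ring of the Chow variety as a `GL_m(ℂ)`-module. -/
noncomputable def coordRep (m d : ℕ) :
    Representation ℂ (GL (Fin m) ℂ) (Subalgebra.toSubmodule (coordRing m d)) :=
  (functionRep m d).subrepresentation _ fun g _ hf => functionRep_mem_coordRing g hf

end Chow

/-- Kumar's conjecture for given `n` and `i`: the `GL_n`-module `S_{(n^i)}` occurs in the coordinate
ring of `Ch_n(ℂ^n)`. Functions on `S^n W` with `W = ℂ^n` form `Sym(S^n W^*)`, so that the Schur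
functor is applied to the dual `W^*` of the defining representation. -/
def KumarConjecture (n i : ℕ) : Prop :=
  ∃ f : ((YoungDiagram.rectangle i n).schurRep (stdRep n).dual).IntertwiningMap
      (Chow.coordRep n n),
    Function.Injective f

/-! ### The pairing between polynomials and differential operators -/

namespace MvPolynomial

theorem commute_pderiv {ι : Type*} (i j : ι) :
    Commute (pderiv (R := ℂ) i : Module.End ℂ (MvPolynomial ι ℂ))
      (pderiv (R := ℂ) j : Module.End ℂ (MvPolynomial ι ℂ)) := by
  classical
  have h : ⁅pderiv (R := ℂ) i, pderiv (R := ℂ) j⁆ = 0 := by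
    apply MvPolynomial.derivation_ext
    intro k
    simp only [Derivation.commutator_apply, pderiv_X, Derivation.zero_apply]
    by_cases h1 : j = k <;> by_cases h2 : i = k <;> simp [h1, h2]
  refine LinearMap.ext fun p => ?_
  have := congrArg (fun D => D p) h
  simpa [Derivation.commutator_apply, sub_eq_zero] using this

theorem pairwise_commute_pderiv_pow {ι : Type*} (α : ι →₀ ℕ) :
    (α.support : Set ι).Pairwise (Function.onFun Commute fun i =>
      (pderiv (R := ℂ) i : Module.End ℂ (MvPolynomial ι ℂ)) ^ α i) :=
  fun i _ j _ _ => (commute_pderiv i j).pow_pow (α i) (α j)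

/-- The differential operator `∂^α = ∏ᵢ (∂/∂xᵢ)^{αᵢ}`. -/
noncomputable def partialMonomial {ι : Type*} (α : ι →₀ ℕ) : Module.End ℂ (MvPolynomial ι ℂ) :=
  α.support.noncommProd
    (fun i => (pderiv (R := ℂ) i : Module.End ℂ (MvPolynomial ι ℂ)) ^ α i)
    (pairwise_commute_pderiv_pow α)

/-- The constant coefficient differential operator `P(∂/∂x)`, obtained from `P(y)` by letting the
dual coordinate `yᵢ` act as `∂/∂xᵢ`. -/
noncomputable def diffOp {ι : Type*} (P : MvPolynomial ι ℂ) : Module.End ℂ (MvPolynomial ι ℂ) :=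
  ∑ α ∈ P.support, P.coeff α • partialMonomial α

/-- The pairing `⟨P(y), Q(x)⟩`: the differential operator `P(∂/∂x)` applied to `Q`, evaluated
at `0`. (For `P` and `Q` homogeneous of the same degree, `P(∂/∂x) Q` is already a constant.) -/
noncomputable def polarPairing {ι : Type*} (P Q : MvPolynomial ι ℂ) : ℂ :=
  constantCoeff (diffOp P Q)

end MvPolynomial

/-! ### Polynomial functions on matrices -/

/-! Every statement is compared with the single number I = ∫ ∏ g_ij over SU(n), and each turns out
to be equivalent to I ≠ 0. The engine is that a homogeneous polynomial of degree n² in a matrix V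
which is constant on SU(n) is a multiple of det(V)^n, since U(n) is Zariski dense among all matrices
(`eq_C_mul_det_pow_of_specialUnitary`). By invariance of Haar measure this applies to V ↦ ∫ F(Vg) dg
for F homogeneous of degree n², and it is used twice.

With F = tr^(n²), comparing coefficients in V shows that integration of polynomials of degree n² is
a nonzero constant c times the pairing with det^n (`specialUnitaryIntegral_eq_polarPairing`). This
settles the two pairings and gives I = c·D, where D is the coefficient of ∏ x_ij in det^n
(`detPowCoeff`). D counts Latin squares weighted by their row signs; exchanging the roles of rows,
columns and symbols turns this, up to a global sign, into the Alon–Tarsi difference.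

With F = ∏ a_ij, one gets ∫ ∏ (Vg)_ij dg = I·det(V)^n. The coefficient of ∏ v_ij gives ∫ perm^n =
I·D, which is nonzero exactly when I is.

For Kumar's conjecture, the Schur module is a line with character det^(-n), so the question is
whether a nonzero semi-invariant f exists. If I ≠ 0, then f(p) = ∫ ∏_l p(l-th column of g) dg works,
with value I·det(w)^n at w_1⋯w_n. Conversely, f pulled back to matrices of columns is c'·det^n, and
it is also a polynomial in the evaluations p ↦ p(v). Its part of degree n² consists of products of n
evaluations, whose integrals are multiples of I; so I = 0 forces c' = 0 and f = 0. -/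

namespace MvPolynomial

/-- The value at the matrix `A` of a polynomial in the entries of a generic matrix. -/
noncomputable def evalMatrix {m n R : Type*} [CommRing R] (A : Matrix m n R) :
    MvPolynomial (m × n) R →+* R :=
  eval fun p => A p.1 p.2

@[simp]
theorem evalMatrix_X {m n R : Type*} [CommRing R] (A : Matrix m n R) (p : m × n) :
    evalMatrix A (X p) = A p.1 p.2 := eval_X p

@[simp]
theorem evalMatrix_C {m n R : Type*} [CommRing R] (A : Matrix m n R) (r : R) :
    evalMatrix A (C r) = r := eval_C r

theorem evalMatrix_det {n R : Type*} [CommRing R] [Fintype n] [DecidableEq n] (A : Matrix n n R) :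
    evalMatrix A (Matrix.mvPolynomialX n n R).det = A.det := by
  rw [RingHom.map_det]
  congr 1
  ext i j
  simp

theorem evalMatrix_permanent {n R : Type*} [CommRing R] [Fintype n] [DecidableEq n]
    (A : Matrix n n R) :
    evalMatrix A (Matrix.mvPolynomialX n n R).permanent = A.permanent := by
  simp [Matrix.permanent, map_sum, map_prod]

theorem IsHomogeneous.finsuppSum_eq {σ R : Type*} [CommRing R] {p : MvPolynomial σ R} {d : ℕ}
    (hp : p.IsHomogeneous d) {α : σ →₀ ℕ} (hα : α ∈ p.support) : (α.sum fun _ k => k) = d := by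
  have := hp (mem_support_iff.mp hα)
  rw [Finsupp.weight_apply] at this
  simpa using this

theorem IsHomogeneous.eval_smul {σ R : Type*} [CommRing R] {p : MvPolynomial σ R} {d : ℕ}
    (hp : p.IsHomogeneous d) (t : R) (x : σ → R) : eval (t • x) p = t ^ d * eval x p := by
  simp only [eval_eq, Finset.mul_sum]
  refine Finset.sum_congr rfl fun α hα => ?_
  have h : ∑ i ∈ α.support, α i = d := hp.finsuppSum_eq hα
  simp only [Pi.smul_apply, smul_eq_mul, mul_pow, Finset.prod_mul_distrib,
    Finset.prod_pow_eq_pow_sum, h]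
  ring

end MvPolynomial

/-! ### Zariski density of the unitary group -/

namespace Matrix

open MvPolynomial

variable {n : ℕ}

theorem isHomogeneous_det_mvPolynomialX :
    (mvPolynomialX (Fin n) (Fin n) ℂ).det.IsHomogeneous n := by
  rw [det_apply']
  refine IsHomogeneous.sum _ _ _ fun σ _ => ?_
  have h := (isHomogeneous_C (Fin n × Fin n) ((Equiv.Perm.sign σ : ℤ) : ℂ)).mul
    (IsHomogeneous.prod Finset.univ (fun i => mvPolynomialX (Fin n) (Fin n) ℂ (σ i) i)
      (fun _ => 1) fun i _ => isHomogeneous_X ℂ _)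
  simpa using h

theorem isHomogeneous_permanent_mvPolynomialX :
    (mvPolynomialX (Fin n) (Fin n) ℂ).permanent.IsHomogeneous n := by
  refine IsHomogeneous.sum _ _ _ fun σ _ => ?_
  simpa using IsHomogeneous.prod Finset.univ (fun i => mvPolynomialX (Fin n) (Fin n) ℂ (σ i) i)
      (fun _ => 1) fun i _ => isHomogeneous_X ℂ _

/-- A polynomial vanishing on all unitary matrices vanishes on all Hermitian matrices. -/
theorem evalMatrix_eq_zero_of_isHermitian {Q : MvPolynomial (Fin n × Fin n) ℂ}
    (hQ : ∀ U ∈ unitaryGroup (Fin n) ℂ, evalMatrix U Q = 0)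
    {H : Matrix (Fin n) (Fin n) ℂ} (hH : H.IsHermitian) : evalMatrix H Q = 0 := by
  set U : Matrix (Fin n) (Fin n) ℂ := (hH.eigenvectorUnitary).1
  have hU : U ∈ unitaryGroup (Fin n) ℂ := hH.eigenvectorUnitary.2
  -- The eigenvalues of H = U diag(λ) U* are replaced by free variables z. For z on the unit torus
  -- the matrix is unitary, and a polynomial vanishing on a product of infinite sets is zero, so the
  -- real eigenvalues may be substituted.
  set R : MvPolynomial (Fin n) ℂ :=
    aeval (fun p : Fin n × Fin n => ∑ k, C (U p.1 k * star (U p.2 k)) * X k) Q with hR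
  have key : ∀ z : Fin n → ℂ, eval z R = evalMatrix (U * diagonal z * star U) Q := by
    intro z
    rw [hR, aeval_def, ← coe_eval₂Hom, ← RingHom.comp_apply]
    congr 1
    ext p
    · simp
    · simp [mul_apply, diagonal_apply, mul_right_comm _ (z _)]
  have h0 : R = 0 := by
    refine funext_set (fun _ => {z : ℂ | z * star z = 1}) (fun _ => ?_) fun z hz => ?_
    · have hinf : (Metric.sphere (0 : ℂ) 1).Infinite :=
        -- The points exp(i/(k+1)) have arguments in (0, 1], hence are distinguished by
        -- `Complex.arg`.
        Set.infinite_of_injective_forall_mem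
          (f := fun k : ℕ => Complex.exp (((1 / (k + 1) : ℝ) : ℂ) * Complex.I)) (by
            intro a b hab
            have ha : Complex.arg (Complex.exp (((1 / (a + 1) : ℝ) : ℂ) * Complex.I))
              = 1 / (a + 1) := Complex.arg_exp_mul_I _ ▸ (toIocMod_eq_self _).2 (by
                have h1 : (0 : ℝ) < 1 / (a + 1) := by positivity
                have h2 : (1 : ℝ) / (a + 1) ≤ 1 := by
                  rw [div_le_one (by positivity)]; linarith [(Nat.cast_nonneg a : (0 : ℝ) ≤ a)]
                constructor <;> linarith [Real.pi_gt_three])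
            have hb : Complex.arg (Complex.exp (((1 / (b + 1) : ℝ) : ℂ) * Complex.I))
              = 1 / (b + 1) := Complex.arg_exp_mul_I _ ▸ (toIocMod_eq_self _).2 (by
                have h1 : (0 : ℝ) < 1 / (b + 1) := by positivity
                have h2 : (1 : ℝ) / (b + 1) ≤ 1 := by
                  rw [div_le_one (by positivity)]; linarith [(Nat.cast_nonneg b : (0 : ℝ) ≤ b)]
                constructor <;> linarith [Real.pi_gt_three])
            have := (ha.symm.trans (congrArg Complex.arg hab)).trans hb
            have h3 : ((a : ℝ) + 1) = b + 1 := by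
              field_simp at this; linarith
            exact_mod_cast (add_right_cancel h3)) (by
            intro k
            simp [Complex.norm_exp])
      refine hinf.mono fun z hz => ?_
      have h1 : ‖z‖ = 1 := by simpa using hz
      simp [Complex.mul_conj, Complex.normSq_eq_norm_sq, h1]
    · rw [key, map_zero]
      refine hQ _ (mul_mem (mul_mem hU ?_) (Unitary.star_mem hU))
      rw [mem_unitaryGroup_iff, star_eq_conjTranspose, diagonal_conjTranspose,
        diagonal_mul_diagonal, ← diagonal_one]
      congr 1
      ext i
      exact hz i trivial
  have h1 := key (fun i => (hH.eigenvalues i : ℂ))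
  rw [h0, map_zero] at h1
  rw [hH.spectral_theorem, Unitary.conjStarAlgAut_apply]
  exact h1.symm

/-- The unitary group is Zariski dense in the space of all matrices. -/
theorem eq_zero_of_evalMatrix_unitary_eq_zero {Q : MvPolynomial (Fin n × Fin n) ℂ}
    (hQ : ∀ U ∈ unitaryGroup (Fin n) ℂ, evalMatrix U Q = 0) : Q = 0 := by
  -- This is Q at B + B* with B = Y + iZ for real matrices Y and Z, written without conjugation so
  -- that Y and Z can later become complex.
  set R : MvPolynomial ((Fin n × Fin n) ⊕ (Fin n × Fin n)) ℂ :=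
    aeval (fun p : Fin n × Fin n => X (Sum.inl p) + C Complex.I * X (Sum.inr p) +
      (X (Sum.inl p.swap) - C Complex.I * X (Sum.inr p.swap))) Q with hR
  have key : ∀ z : (Fin n × Fin n) ⊕ (Fin n × Fin n) → ℂ, eval z R =
      evalMatrix (of fun i j => z (Sum.inl (i, j)) + Complex.I * z (Sum.inr (i, j)) +
        (z (Sum.inl (j, i)) - Complex.I * z (Sum.inr (j, i)))) Q := by
    intro z
    rw [hR, aeval_def, ← coe_eval₂Hom, ← RingHom.comp_apply]
    congr 1
    ext p <;> simp [Prod.swap]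
  have h0 : R = 0 := by
    refine funext_set (fun _ => Set.range ((↑) : ℝ → ℂ))
      (fun _ => Set.infinite_range_of_injective Complex.ofReal_injective) fun z hz => ?_
    rw [key, map_zero]
    apply evalMatrix_eq_zero_of_isHermitian hQ
    have hreal : ∀ s, star (z s) = z s := fun s => by
      obtain ⟨r, hr⟩ := hz s trivial
      rw [← hr]; simp
    ext i j
    simp only [conjTranspose_apply, of_apply, star_add, star_sub, star_mul', hreal]
    simp only [RCLike.star_def, Complex.conj_I]
    ring
  apply MvPolynomial.funext
  intro x
  -- With Y = x/2 and Z = x/(2i) the sum Y + iZ is x, while the transposed part cancels.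
  have h1 := key (Sum.elim (fun p => x p / 2) fun p => x p / (2 * Complex.I))
  rw [h0, map_zero] at h1
  rw [map_zero, h1]
  change _ = eval _ Q
  congr 2
  ext p
  simp only [of_apply, Sum.elim_inl, Sum.elim_inr, Prod.mk.eta]
  field_simp [Complex.I_ne_zero]
  ring

/-- A homogeneous polynomial of degree `n * n` that is constant on `SU(n)` is a multiple of the
`n`-th power of the determinant. -/
theorem eq_C_mul_det_pow_of_specialUnitary {Q : MvPolynomial (Fin n × Fin n) ℂ}
    (hQ : Q.IsHomogeneous (n * n)) {c : ℂ}
    (h : ∀ g ∈ specialUnitaryGroup (Fin n) ℂ, evalMatrix g Q = c) :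
    Q = C c * (mvPolynomialX (Fin n) (Fin n) ℂ).det ^ n := by
  rw [← sub_eq_zero]
  refine eq_zero_of_evalMatrix_unitary_eq_zero fun U hU => ?_
  -- Write U = t·g with g in SU(n); homogeneity then gives Q(U) = t^(n²)·c = c·det(U)^n.
  obtain ⟨t, ht, ht'⟩ : ∃ t : ℂ, t ^ n = U.det ∧ t * star t = 1 := by
    have hd : U.det * star U.det = 1 := (det_of_mem_unitary hU).2
    have hd1 : ‖U.det‖ = 1 := by
      have := congrArg norm hd
      rw [norm_mul, norm_star, norm_one] at this
      nlinarith [norm_nonneg U.det]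
    rcases Nat.eq_zero_or_pos n with rfl | hn
    · exact ⟨1, by simp⟩
    · obtain ⟨t, ht⟩ := IsAlgClosed.exists_pow_nat_eq U.det hn
      refine ⟨t, ht, ?_⟩
      have : ‖t‖ ^ n = 1 := by rw [← norm_pow, ht, hd1]
      have h1 := (pow_eq_one_iff_of_nonneg (norm_nonneg t) hn.ne').mp this
      simp [Complex.mul_conj, Complex.normSq_eq_norm_sq, h1]
  have htn : t ≠ 0 := by rintro rfl; simp at ht'
  have hst : star t * t = 1 := by rw [mul_comm, ht']
  have hU' : U = t • (star t • U) := by rw [smul_smul, ht', one_smul]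
  have hg : star t • U ∈ specialUnitaryGroup (Fin n) ℂ := by
    refine mem_specialUnitaryGroup_iff.2 ⟨?_, ?_⟩
    · rw [mem_unitaryGroup_iff, star_smul, star_star, smul_mul_smul_comm, hst,
        mem_unitaryGroup_iff.1 hU, one_smul]
    · rw [det_smul, Fintype.card_fin, ← ht, ← mul_pow, hst, one_pow]
  have h1 : evalMatrix U Q = t ^ (n * n) * c := by
    rw [← h _ hg, evalMatrix, evalMatrix, ← hQ.eval_smul]
    congr 2
    ext p
    simp only [Pi.smul_apply, smul_apply, smul_eq_mul]
    rw [← mul_assoc, ht', one_mul]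
  rw [map_sub, map_mul, map_pow, evalMatrix_det, evalMatrix_C, h1, ← ht, ← pow_mul]
  ring

end Matrix

/-! ### The polar pairing in terms of coefficients -/

namespace MvPolynomial

/-- The condition β i = 0 makes the falling factorial produced by k differentiations exactly k!. It
persists when the operators for distinct variables are composed. -/
theorem coeff_pderiv_pow {ι : Type*} (i : ι) (k : ℕ) (Q : MvPolynomial ι ℂ) {β : ι →₀ ℕ}
    (hβ : β i = 0) :
    coeff β (((pderiv (R := ℂ) i : Module.End ℂ (MvPolynomial ι ℂ)) ^ k) Q) =
      k.factorial * coeff (β + Finsupp.single i k) Q := by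
  induction k generalizing Q with
  | zero => simp
  | succ k ih =>
    rw [pow_succ, Module.End.mul_apply, ih, Derivation.coeFn_coe, coeff_pderiv, add_assoc,
      ← Finsupp.single_add]
    simp only [Finsupp.add_apply, hβ, Finsupp.single_eq_same, zero_add, Nat.factorial_succ]
    push_cast
    ring

theorem coeff_noncommProd_pderiv {ι : Type*} [DecidableEq ι] (α : ι →₀ ℕ) (s : Finset ι)
    (hs : (s : Set ι).Pairwise (Function.onFun Commute fun i =>
      (pderiv (R := ℂ) i : Module.End ℂ (MvPolynomial ι ℂ)) ^ α i))
    (Q : MvPolynomial ι ℂ) {β : ι →₀ ℕ} (hβ : ∀ i ∈ s, β i = 0) :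
    coeff β (s.noncommProd
      (fun i => (pderiv (R := ℂ) i : Module.End ℂ (MvPolynomial ι ℂ)) ^ α i) hs Q) =
      (∏ i ∈ s, ((α i).factorial : ℂ)) * coeff (β + ∑ i ∈ s, Finsupp.single i (α i)) Q := by
  induction s using Finset.induction_on generalizing Q β with
  | empty => simp
  | insert a s ha ih =>
    rw [Finset.noncommProd_insert_of_notMem _ _ _ _ ha, Module.End.mul_apply,
      coeff_pderiv_pow _ _ _ (hβ a (Finset.mem_insert_self a s)), ih, Finset.prod_insert ha,
      Finset.sum_insert ha]
    · rw [mul_assoc, add_assoc]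
    · intro i hi
      have hia : a ≠ i := fun h => ha (h ▸ hi)
      simp [hβ i (Finset.mem_insert_of_mem hi), hia]

theorem constantCoeff_partialMonomial {ι : Type*} (α : ι →₀ ℕ) (Q : MvPolynomial ι ℂ) :
    constantCoeff (partialMonomial α Q) = (α.prod fun _ k => (k.factorial : ℂ)) * coeff α Q := by
  classical
  rw [constantCoeff_eq, partialMonomial, coeff_noncommProd_pderiv _ _ _ _ fun _ _ => rfl, zero_add]
  congr 2
  exact α.sum_single

theorem polarPairing_eq_sum {ι : Type*} (P Q : MvPolynomial ι ℂ) :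
    polarPairing P Q =
      ∑ α ∈ P.support, coeff α P * ((α.prod fun _ k => (k.factorial : ℂ)) * coeff α Q) := by
  simp [polarPairing, diffOp, LinearMap.sum_apply, map_sum, constantCoeff_partialMonomial]

/-! ### Applying a linear form to the coefficients of a polynomial -/

/-- The polynomial obtained by applying a linear form to all coefficients of a polynomial. -/
noncomputable def mapCoeff {κ B : Type*} [CommRing B] [Algebra ℂ B] (L : B →ₗ[ℂ] ℂ)
    (R : MvPolynomial κ B) : MvPolynomial κ ℂ :=
  ∑ α ∈ R.support, monomial α (L (coeff α R))

section mapCoeff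

variable {κ B : Type*} [CommRing B] [Algebra ℂ B] (L : B →ₗ[ℂ] ℂ) (R : MvPolynomial κ B)

theorem coeff_mapCoeff (α : κ →₀ ℕ) : coeff α (mapCoeff L R) = L (coeff α R) := by
  classical
  simp only [mapCoeff, coeff_sum, coeff_monomial, Finset.sum_ite_eq', mem_support_iff]
  split_ifs with h
  · rfl
  · rw [not_not.mp h, map_zero]

theorem eval_mapCoeff (v : κ → ℂ) :
    eval v (mapCoeff L R) = L (eval (fun k => algebraMap ℂ B (v k)) R) := by
  rw [mapCoeff, map_sum, eval_eq, map_sum]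
  refine Finset.sum_congr rfl fun α _ => ?_
  simp only [← map_pow, ← map_prod]
  rw [eval_monomial, mul_comm (coeff α R), ← Algebra.smul_def, map_smul, smul_eq_mul, mul_comm]
  rfl

variable {R}

theorem IsHomogeneous.mapCoeff {d : ℕ} (hR : R.IsHomogeneous d) :
    (mapCoeff L R).IsHomogeneous d := by
  intro α hα
  refine hR fun h => hα ?_
  rw [coeff_mapCoeff, h, map_zero]

end mapCoeff

end MvPolynomial

/-! ### Integration over the special unitary group -/

namespace Matrix

open MvPolynomial MeasureTheory

variable {n : ℕ}

/-- A closed set of matrices with entries in the unit disc. Compactness makes all polynomial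
integrands integrable and the Haar measure finite. -/
instance : CompactSpace (specialUnitaryGroup (Fin n) ℂ) := by
  refine (isCompact_iff_compactSpace (s := ((specialUnitaryGroup (Fin n) ℂ :
    Submonoid (Matrix (Fin n) (Fin n) ℂ)) : Set (Matrix (Fin n) (Fin n) ℂ)))).1 ?_
  have hK : IsCompact (Set.pi Set.univ fun _ : Fin n =>
      Set.pi Set.univ fun _ : Fin n => Metric.closedBall (0 : ℂ) 1) :=
    isCompact_univ_pi fun _ => isCompact_univ_pi fun _ => isCompact_closedBall _ _
  refine IsCompact.of_isClosed_subset (X := Matrix (Fin n) (Fin n) ℂ) hK ?_ fun U hU => ?_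
  · have h : ((specialUnitaryGroup (Fin n) ℂ : Submonoid _) : Set (Matrix (Fin n) (Fin n) ℂ)) =
        {A | A * star A = 1} ∩ {A | A.det = 1} := by
      ext A
      simp only [SetLike.mem_coe, mem_specialUnitaryGroup_iff, mem_unitaryGroup_iff]
      rfl
    rw [h]
    exact (isClosed_eq (by fun_prop) continuous_const).inter
      (isClosed_eq (by fun_prop) continuous_const)
  · intro i _ j _
    simpa using entry_norm_bound_of_unitary (specialUnitaryGroup_le_unitaryGroup hU) i j

theorem continuous_evalMatrix_specialUnitary (p : MvPolynomial (Fin n × Fin n) ℂ) :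
    Continuous fun g : specialUnitaryGroup (Fin n) ℂ =>
      evalMatrix (g : Matrix (Fin n) (Fin n) ℂ) p := by
  refine (MvPolynomial.continuous_eval p).comp (continuous_pi fun q => ?_)
  exact continuous_subtype_val.matrix_elem q.1 q.2

theorem transpose_mem_specialUnitaryGroup {V : Matrix (Fin n) (Fin n) ℂ}
    (hV : V ∈ specialUnitaryGroup (Fin n) ℂ) : Vᵀ ∈ specialUnitaryGroup (Fin n) ℂ := by
  rw [mem_specialUnitaryGroup_iff, mem_unitaryGroup_iff] at *
  refine ⟨?_, by rw [det_transpose, hV.2]⟩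
  have h : star V * V = 1 := mul_eq_one_comm.1 hV.1
  have h2 : star Vᵀ = (star V)ᵀ := rfl
  rw [h2, ← transpose_mul, h, transpose_one]

variable [MeasurableSpace (specialUnitaryGroup (Fin n) ℂ)]
  [BorelSpace (specialUnitaryGroup (Fin n) ℂ)]
  (μ : Measure (specialUnitaryGroup (Fin n) ℂ)) [μ.IsHaarMeasure]

theorem integrable_specialUnitary {f : specialUnitaryGroup (Fin n) ℂ → ℂ} (hf : Continuous f) :
    Integrable f μ :=
  hf.integrable_of_hasCompactSupport (HasCompactSupport.of_compactSpace f)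

/-- Integration of polynomials in the matrix entries over `SU(n)`. -/
noncomputable def specialUnitaryIntegral : MvPolynomial (Fin n × Fin n) ℂ →ₗ[ℂ] ℂ where
  toFun p := ∫ g : specialUnitaryGroup (Fin n) ℂ, evalMatrix (g : Matrix (Fin n) (Fin n) ℂ) p ∂μ
  map_add' p q := by
    simp only [map_add]
    exact integral_add (integrable_specialUnitary μ (continuous_evalMatrix_specialUnitary p))
      (integrable_specialUnitary μ (continuous_evalMatrix_specialUnitary q))
  map_smul' c p := by
    simp only [smul_eval, evalMatrix, integral_const_mul, RingHom.id_apply, smul_eq_mul]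

theorem specialUnitaryIntegral_apply (p : MvPolynomial (Fin n × Fin n) ℂ) :
    specialUnitaryIntegral μ p =
      ∫ g : specialUnitaryGroup (Fin n) ℂ, evalMatrix (g : Matrix (Fin n) (Fin n) ℂ) p ∂μ := rfl

/-- The integrand is identically 1, so the integral is the total mass, which is positive and finite.
-/
theorem specialUnitaryIntegral_det_pow_ne_zero (k : ℕ) :
    specialUnitaryIntegral μ ((mvPolynomialX (Fin n) (Fin n) ℂ).det ^ k) ≠ 0 := by
  have h : ∀ g : specialUnitaryGroup (Fin n) ℂ, evalMatrix (g : Matrix (Fin n) (Fin n) ℂ)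
      ((mvPolynomialX (Fin n) (Fin n) ℂ).det ^ k) = 1 := fun g => by
    rw [map_pow, evalMatrix_det, (mem_specialUnitaryGroup_iff.1 g.2).2, one_pow]
  have hfin : IsFiniteMeasure μ := inferInstance
  simp only [specialUnitaryIntegral_apply, h, integral_const]
  have : μ.real Set.univ ≠ 0 := by
    rw [Measure.real, ENNReal.toReal_ne_zero]
    exact ⟨(Measure.measure_univ_ne_zero.2 (NeZero.ne μ)), measure_ne_top _ _⟩
  simpa using this

/-- The integral over `SU(n)` of a family of polynomials that is homogeneous of degree `n * n` in a
matrix parameter, and depends on the parameter through a translation. -/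
theorem mapCoeff_specialUnitaryIntegral
    {R : MvPolynomial (Fin n × Fin n) (MvPolynomial (Fin n × Fin n) ℂ)}
    (hR : R.IsHomogeneous (n * n)) (F : Matrix (Fin n) (Fin n) ℂ → ℂ)
    (hF : ∀ V ∈ specialUnitaryGroup (Fin n) ℂ, ∃ h ∈ specialUnitaryGroup (Fin n) ℂ,
      ∀ g : Matrix (Fin n) (Fin n) ℂ,
        evalMatrix g (eval (fun p => C (V p.1 p.2)) R) = F (h * g)) :
    mapCoeff (specialUnitaryIntegral μ) R =
      C (∫ g : specialUnitaryGroup (Fin n) ℂ, F g ∂μ) *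
        (mvPolynomialX (Fin n) (Fin n) ℂ).det ^ n := by
  -- The outer variables of R form the parameter V and the inner ones the group element. At V in
  -- SU(n) the integral is that of F(hg), independent of V by left invariance.
  refine eq_C_mul_det_pow_of_specialUnitary (hR.mapCoeff _) fun V hV => ?_
  obtain ⟨h, hh, hF⟩ := hF V hV
  rw [evalMatrix, eval_mapCoeff, specialUnitaryIntegral_apply]
  simp only [MvPolynomial.algebraMap_eq, hF]
  exact integral_mul_left_eq_self (μ := μ)
    (fun g : specialUnitaryGroup (Fin n) ℂ => F g) ⟨h, hh⟩

/-- The function tr(Vᵀg)^(n²) = (∑ v_p g_p)^(n²) generates all monomials of degree n² in g: its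
coefficient at v^α is g^α times the multinomial coefficient (n²)!/α!. -/
theorem specialUnitaryIntegral_monomial {α : Fin n × Fin n →₀ ℕ}
    (hα : (α.sum fun _ k => k) = n * n) :
    specialUnitaryIntegral μ (monomial α 1) =
      (∫ g : specialUnitaryGroup (Fin n) ℂ,
        (g : Matrix (Fin n) (Fin n) ℂ).trace ^ (n * n) ∂μ) / (n * n).factorial *
      ((α.prod fun _ k => (k.factorial : ℂ)) *
        coeff α ((mvPolynomialX (Fin n) (Fin n) ℂ).det ^ n)) := by
  have hR := mapCoeff_specialUnitaryIntegral μ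
    (R := (∑ p, X p • X p) ^ (n * n)) (by
      have h := (IsHomogeneous.sum Finset.univ (fun p : Fin n × Fin n =>
        (X p • X p : MvPolynomial _ (MvPolynomial (Fin n × Fin n) ℂ))) 1
        fun p _ => by rw [smul_eq_C_mul]; exact isHomogeneous_C_mul_X _ _).pow (n * n)
      rwa [one_mul] at h) (fun A => A.trace ^ (n * n)) (by
      intro V hV
      refine ⟨Vᵀ, transpose_mem_specialUnitaryGroup hV, fun g => ?_⟩
      simp only [map_pow, map_sum, smul_eq_C_mul, map_mul, eval_C, eval_X, evalMatrix_X, evalMatrix_C]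
      congr 1
      simp only [trace, diag_apply, mul_apply, transpose_apply, Fintype.sum_prod_type]
      rw [Finset.sum_comm]
      exact Finset.sum_congr rfl fun i _ => Finset.sum_congr rfl fun j _ => mul_comm _ _)
  have h1 := congrArg (coeff α) hR
  rw [coeff_mapCoeff, coeff_linearCombination_X_pow_of_fintype, if_pos hα, coeff_C_mul] at h1
  have hprod : (α.prod fun r m => (X r : MvPolynomial (Fin n × Fin n) ℂ) ^ m) = monomial α 1 := by
    rw [monomial_eq, C_1, one_mul]
  have hmul : (α.multinomial : ℂ) * (α.prod fun _ k => (k.factorial : ℂ)) =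
      ((n * n).factorial : ℂ) := by
    have h := Nat.multinomial_spec α.support α
    rw [← show (α.sum fun _ k => k) = n * n from hα, mul_comm, Finsupp.multinomial_eq,
      Finsupp.prod]
    exact_mod_cast h
  have hne : (α.prod fun _ k => (k.factorial : ℂ)) ≠ 0 := by
    intro h
    rw [h, mul_zero] at hmul
    exact (Nat.cast_ne_zero.2 (Nat.factorial_ne_zero _)) hmul.symm
  have hne' : (α.multinomial : ℂ) ≠ 0 := by
    intro h
    rw [h, zero_mul] at hmul
    exact (Nat.cast_ne_zero.2 (Nat.factorial_ne_zero _)) hmul.symm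
  rw [hprod, ← nsmul_eq_mul, map_nsmul, nsmul_eq_mul] at h1
  rw [← hmul, ← mul_right_inj' hne', h1]
  field_simp

/-- Integration over `SU(n)` agrees up to a nonzero factor with the pairing with the `n`-th power of
the determinant. -/
theorem specialUnitaryIntegral_eq_polarPairing :
    ∃ c : ℂ, c ≠ 0 ∧ ∀ P : MvPolynomial (Fin n × Fin n) ℂ, P.IsHomogeneous (n * n) →
      specialUnitaryIntegral μ P =
        c * polarPairing P ((mvPolynomialX (Fin n) (Fin n) ℂ).det ^ n) := by
  set c : ℂ := (∫ g : specialUnitaryGroup (Fin n) ℂ,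
        (g : Matrix (Fin n) (Fin n) ℂ).trace ^ (n * n) ∂μ) / (n * n).factorial with hc
  have key : ∀ P : MvPolynomial (Fin n × Fin n) ℂ, P.IsHomogeneous (n * n) →
      specialUnitaryIntegral μ P =
        c * polarPairing P ((mvPolynomialX (Fin n) (Fin n) ℂ).det ^ n) := by
    intro P hP
    rw [polarPairing_eq_sum, Finset.mul_sum]
    conv_lhs => rw [P.as_sum, map_sum]
    refine Finset.sum_congr rfl fun α hα => ?_
    have h1 : monomial α (coeff α P) = coeff α P • monomial α (1 : ℂ) := by
      rw [smul_monomial, smul_eq_mul, mul_one]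
    rw [h1, map_smul, specialUnitaryIntegral_monomial μ (hP.finsuppSum_eq hα), smul_eq_mul]
    ring
  refine ⟨c, fun h => ?_, key⟩
  -- The constant is nonzero because the test polynomial det^n has nonzero integral.
  refine specialUnitaryIntegral_det_pow_ne_zero μ n ?_
  rw [key _ (isHomogeneous_det_mvPolynomialX.pow n), h, zero_mul]

theorem mapCoeff_prod_mul :
    mapCoeff (specialUnitaryIntegral μ)
      (∏ k, ∏ j, ∑ i, X (k, i) * C (X (i, j)) :
        MvPolynomial (Fin n × Fin n) (MvPolynomial (Fin n × Fin n) ℂ)) =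
      C (∫ g : specialUnitaryGroup (Fin n) ℂ, ∏ i, ∏ j, (g : Matrix (Fin n) (Fin n) ℂ) i j ∂μ) *
        (mvPolynomialX (Fin n) (Fin n) ℂ).det ^ n := by
  refine mapCoeff_specialUnitaryIntegral μ ?_ (fun A => ∏ i, ∏ j, A i j) fun V hV =>
    ⟨V, hV, fun g => ?_⟩
  · have h := IsHomogeneous.prod Finset.univ (fun k : Fin n =>
      (∏ j, ∑ i, X (k, i) * C (X (i, j)) :
        MvPolynomial (Fin n × Fin n) (MvPolynomial (Fin n × Fin n) ℂ))) (fun _ => n) fun k _ => by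
        have h := IsHomogeneous.prod Finset.univ (fun j : Fin n => (∑ i, X (k, i) * C (X (i, j)) :
          MvPolynomial (Fin n × Fin n) (MvPolynomial (Fin n × Fin n) ℂ))) (fun _ => 1) fun j _ =>
            IsHomogeneous.sum _ _ _ fun i _ => by
              rw [mul_comm]; exact isHomogeneous_C_mul_X _ _
        simpa using h
    simpa using h
  · simp [map_prod, map_sum, mul_apply]

/-- The integral over `SU(n)` of the product of all matrix entries, after a translation by an
arbitrary matrix. -/
theorem integral_prod_mul_eq (V : Matrix (Fin n) (Fin n) ℂ) :
    ∫ g : specialUnitaryGroup (Fin n) ℂ, ∏ i, ∏ j, (V * (g : Matrix (Fin n) (Fin n) ℂ)) i j ∂μ =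
      (∫ g : specialUnitaryGroup (Fin n) ℂ, ∏ i, ∏ j, (g : Matrix (Fin n) (Fin n) ℂ) i j ∂μ) *
        V.det ^ n := by
  have h := congrArg (evalMatrix V) (mapCoeff_prod_mul μ)
  rw [map_mul, map_pow, evalMatrix_det, evalMatrix_C, evalMatrix, eval_mapCoeff,
    specialUnitaryIntegral_apply] at h
  rw [← h]
  simp [map_prod, map_sum, mul_apply]

end Matrix

/-! ### The squarefree coefficient of det^n and of the translated product of entries -/

namespace MvPolynomial

/-- The exponent of the squarefree monomial in all variables. -/
noncomputable def allOnes (ι : Type*) [Fintype ι] : ι →₀ ℕ := ∑ p, Finsupp.single p 1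

theorem prod_X_eq_monomial_sum {κ ι R : Type*} [CommRing R] [Fintype κ] (t : κ → ι) :
    (∏ q, X (t q) : MvPolynomial ι R) = monomial (∑ q, Finsupp.single (t q) 1) 1 := by
  rw [monomial_sum_one]
  rfl

theorem coeff_allOnes_prod_X {ι R : Type*} [CommRing R] [Fintype ι] [DecidableEq ι]
    (t : ι → ι) [Decidable (Function.Bijective t)] :
    coeff (allOnes ι) (∏ q, X (t q) : MvPolynomial ι R) =
      if Function.Bijective t then 1 else 0 := by
  rw [prod_X_eq_monomial_sum, coeff_monomial]
  refine if_congr ⟨fun h => ?_, fun h => ?_⟩ rfl rfl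
  · refine Function.Surjective.bijective_of_finite fun p => ?_
    by_contra! hp
    have := DFunLike.congr_fun h p
    simp [allOnes, Finsupp.finsetSum_apply, Finsupp.single_apply, hp] at this
  · exact (Equiv.ofBijective t h).sum_comp fun p => Finsupp.single p 1

end MvPolynomial

namespace Matrix

open MvPolynomial MeasureTheory

variable {n : ℕ}

/-- The coefficient of `∏ xᵢⱼ` in the `n`-th power of the determinant. -/
noncomputable def detPowCoeff (n : ℕ) : ℂ :=
  coeff (allOnes (Fin n × Fin n)) ((mvPolynomialX (Fin n) (Fin n) ℂ).det ^ n)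

/-- Expanding chooses an index s(k, j) for each factor. The monomial in V is squarefree exactly when
every s(k, ·) is a permutation, and the choices for the n values of k are independent, giving one
permanent each. -/
theorem coeff_allOnes_prod_mul :
    coeff (allOnes (Fin n × Fin n)) (∏ k, ∏ j, ∑ i, X (k, i) * C (X (i, j)) :
        MvPolynomial (Fin n × Fin n) (MvPolynomial (Fin n × Fin n) ℂ)) =
      (mvPolynomialX (Fin n) (Fin n) ℂ).permanent ^ n := by
  classical
  have h1 : (∏ k, ∏ j, ∑ i, X (k, i) * C (X (i, j)) :
        MvPolynomial (Fin n × Fin n) (MvPolynomial (Fin n × Fin n) ℂ)) =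
      ∑ s : Fin n × Fin n → Fin n,
        C (∏ q, X (s q, q.2)) * ∏ q : Fin n × Fin n, X (q.1, s q) := by
    rw [← Fintype.prod_prod_type'
      (f := fun k j => (∑ i, X (k, i) * C (X (i, j)) : MvPolynomial (Fin n × Fin n) _)),
      Finset.prod_univ_sum, Fintype.piFinset_univ]
    refine Finset.sum_congr rfl fun s _ => ?_
    rw [Finset.prod_mul_distrib, map_prod, mul_comm]
  have h2 : (mvPolynomialX (Fin n) (Fin n) ℂ).permanent ^ n =
      ∑ σ : Fin n → Equiv.Perm (Fin n), ∏ q : Fin n × Fin n, X (σ q.1 q.2, q.2) := by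
    have h : (mvPolynomialX (Fin n) (Fin n) ℂ).permanent ^ n =
      ∏ _k : Fin n, (mvPolynomialX (Fin n) (Fin n) ℂ).permanent := by simp
    rw [h]
    simp only [permanent]
    rw [Finset.prod_univ_sum, Fintype.piFinset_univ]
    refine Finset.sum_congr rfl fun σ _ => ?_
    rw [Fintype.prod_prod_type]
    rfl
  rw [h1, h2, coeff_sum]
  simp only [coeff_C_mul, coeff_allOnes_prod_X, mul_ite, mul_one, mul_zero]
  rw [← Finset.sum_filter]
  symm
  refine Finset.sum_nbij (fun σ q => σ q.1 q.2) (fun σ _ => ?_) (fun σ _ τ _ h => ?_)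
    (fun s hs => ?_) fun σ _ => rfl
  · simp only [Finset.mem_filter, Finset.mem_univ, true_and]
    refine Function.Injective.bijective_of_finite fun p q hpq => ?_
    simp only [Prod.mk.injEq] at hpq
    obtain ⟨h1, h2⟩ := hpq
    rw [h1] at h2
    exact Prod.ext h1 ((σ _).injective h2)
  · funext k
    ext j : 1
    exact congrFun h (k, j)
  · have hb : Function.Bijective fun q : Fin n × Fin n => (q.1, s q) := by simpa using hs
    have hk : ∀ k, Function.Bijective fun j => s (k, j) := fun k =>
      Function.Injective.bijective_of_finite fun i j hij => by
        have := @hb.1 (k, i) (k, j) (Prod.ext rfl hij)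
        simpa using this
    exact ⟨fun k => Equiv.ofBijective _ (hk k), by simp, rfl⟩

/-- Choosing a permutation σ_k from the k-th determinant gives the monomial ∏ x_{σ_k(j), j}, which
is squarefree exactly when each column j of the array σ_k(j) is a bijection in k. These arrays are
the Latin squares. -/
theorem detPowCoeff_eq_sum [DecidablePred fun σ : Fin n → Equiv.Perm (Fin n) =>
      ∀ i, Function.Bijective fun k => σ k i] :
    detPowCoeff n = ∑ σ : Fin n → Equiv.Perm (Fin n) with ∀ i, Function.Bijective fun k => σ k i,
      ∏ k, ((Equiv.Perm.sign (σ k) : ℤ) : ℂ) := by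
  classical
  have h2 : (mvPolynomialX (Fin n) (Fin n) ℂ).det ^ n =
      ∑ σ : Fin n → Equiv.Perm (Fin n), C (∏ k, ((Equiv.Perm.sign (σ k) : ℤ) : ℂ)) *
        ∏ q : Fin n × Fin n, X (σ q.1 q.2, q.2) := by
    have h : (mvPolynomialX (Fin n) (Fin n) ℂ).det ^ n =
      ∏ _k : Fin n, (mvPolynomialX (Fin n) (Fin n) ℂ).det := by simp
    rw [h]
    simp only [det_apply']
    rw [Finset.prod_univ_sum, Fintype.piFinset_univ]
    refine Finset.sum_congr rfl fun σ _ => ?_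
    rw [Fintype.prod_prod_type, Finset.prod_mul_distrib, map_prod]
    simp
  rw [detPowCoeff, h2, coeff_sum, Finset.sum_filter]
  refine Finset.sum_congr rfl fun σ _ => ?_
  rw [coeff_C_mul, coeff_allOnes_prod_X]
  have hiff : (Function.Bijective fun q : Fin n × Fin n => (σ q.1 q.2, q.2)) ↔
      ∀ i, Function.Bijective fun k => σ k i := by
    refine ⟨fun hb i => Function.Injective.bijective_of_finite fun k l hkl => ?_,
      fun hb => Function.Injective.bijective_of_finite fun p q hpq => ?_⟩
    · have := @hb.1 (k, i) (l, i) (Prod.ext hkl rfl)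
      simpa using this
    · simp only [Prod.mk.injEq] at hpq
      obtain ⟨h1, h2⟩ := hpq
      rw [h2] at h1
      exact Prod.ext ((hb _).1 h1) h2
  simp only [hiff, mul_ite, mul_one, mul_zero]

theorem polarPairing_prod_X (Q : MvPolynomial (Fin n × Fin n) ℂ) :
    polarPairing (∏ i, ∏ j, mvPolynomialX (Fin n) (Fin n) ℂ i j) Q =
      coeff (allOnes (Fin n × Fin n)) Q := by
  classical
  have h1 : ∏ i, ∏ j, mvPolynomialX (Fin n) (Fin n) ℂ i j =
      monomial (allOnes (Fin n × Fin n)) (1 : ℂ) := by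
    rw [allOnes, ← prod_X_eq_monomial_sum, Fintype.prod_prod_type]
    rfl
  have h2 : ∀ p, allOnes (Fin n × Fin n) p = 1 := fun p => by
    simp [allOnes, Finsupp.finsetSum_apply, Finsupp.single_apply]
  rw [h1, polarPairing_eq_sum, support_monomial, if_neg one_ne_zero, Finset.sum_singleton,
    coeff_monomial, if_pos rfl, one_mul, Finsupp.prod]
  simp [h2]

variable [MeasurableSpace (specialUnitaryGroup (Fin n) ℂ)]
  [BorelSpace (specialUnitaryGroup (Fin n) ℂ)]
  (μ : Measure (specialUnitaryGroup (Fin n) ℂ)) [μ.IsHaarMeasure]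

theorem integral_permanent_pow :
    ∫ g : specialUnitaryGroup (Fin n) ℂ, (g : Matrix (Fin n) (Fin n) ℂ).permanent ^ n ∂μ =
      (∫ g : specialUnitaryGroup (Fin n) ℂ, ∏ i, ∏ j, (g : Matrix (Fin n) (Fin n) ℂ) i j ∂μ) *
        detPowCoeff n := by
  have h := congrArg (coeff (allOnes (Fin n × Fin n))) (mapCoeff_prod_mul μ)
  rw [coeff_mapCoeff, coeff_C_mul, coeff_allOnes_prod_mul, specialUnitaryIntegral_apply] at h
  simpa only [map_pow, evalMatrix_permanent, detPowCoeff] using h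

end Matrix

/-! ### Signs of Latin squares -/

namespace LatinSquare

variable {n : ℕ}

/-- The parastrophe of a Latin square in which columns and symbols are exchanged. -/
noncomputable def exchange (L : LatinSquare n) : LatinSquare n where
  entry k i := (L.rowPerm i).symm k
  row_bijective k := by
    refine Function.Injective.bijective_of_finite fun i i' h => ?_
    have h1 : L.entry i ((L.rowPerm i).symm k) = k := (L.rowPerm i).apply_symm_apply k
    have h2 : L.entry i' ((L.rowPerm i').symm k) = k := (L.rowPerm i').apply_symm_apply k
    rw [← h] at h2
    exact (L.col_bijective _).1 (h1.trans h2.symm)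
  col_bijective i := (L.rowPerm i).symm.bijective

theorem exchange_injective : Function.Injective (exchange (n := n)) := by
  intro L M h
  ext i j : 3
  have h1 : L.rowPerm i = M.rowPerm i := by
    apply Equiv.symm_bijective.1
    ext k : 1
    exact congrFun (congrFun (congrArg entry h) k) i
  exact congrFun (congrArg DFunLike.coe h1) j

/-- The signs of the rows of the parastrophe are determined by the sign of the Latin square. -/
theorem prod_sign_rowPerm_exchange (L : LatinSquare n) :
    ∏ k, Equiv.Perm.sign (L.exchange.rowPerm k) =
      Equiv.Perm.sign (Equiv.prodComm (Fin n) (Fin n)) * L.sign := by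
  -- With k the entry at (i, j), the map (i, j) ↦ (k, j) factors as (i, j) ↦ (i, k) ↦ (k, i) ↦ (k,
  -- j). The outer factors are the rows of L and of its parastrophe, so taking signs gives the
  -- relation.
  have h : (Equiv.prodCongrLeft L.colPerm : Equiv.Perm (Fin n × Fin n)) =
      Equiv.prodCongrRight L.exchange.rowPerm * Equiv.prodComm (Fin n) (Fin n) *
        Equiv.prodCongrRight L.rowPerm := by
    ext1 ⟨i, j⟩
    have h1 : (L.rowPerm i).symm (L.rowPerm i j) = j := Equiv.symm_apply_apply _ _
    exact Prod.ext rfl h1.symm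
  have h2 := congrArg Equiv.Perm.sign h
  rw [map_mul, map_mul, Equiv.Perm.sign_prodCongrLeft, Equiv.Perm.sign_prodCongrRight,
    Equiv.Perm.sign_prodCongrRight] at h2
  rw [sign, h2]
  generalize Equiv.Perm.sign (Equiv.prodComm (Fin n) (Fin n)) = a
  generalize ∏ k, Equiv.Perm.sign (L.exchange.rowPerm k) = b
  generalize ∏ k, Equiv.Perm.sign (L.rowPerm k) = c
  rcases Int.units_eq_one_or a with rfl | rfl <;> rcases Int.units_eq_one_or b with rfl | rfl <;>
    rcases Int.units_eq_one_or c with rfl | rfl <;> rfl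

noncomputable instance : Fintype (LatinSquare n) := Fintype.ofFinite _

theorem sum_prod_sign_rowPerm :
    ∑ L : LatinSquare n, ∏ k, (Equiv.Perm.sign (L.rowPerm k) : ℤ) =
      (Equiv.Perm.sign (Equiv.prodComm (Fin n) (Fin n)) : ℤ) *
        ∑ L : LatinSquare n, (L.sign : ℤ) := by
  rw [← (Equiv.ofBijective _ exchange_injective.bijective_of_finite).sum_comp, Finset.mul_sum]
  refine Finset.sum_congr rfl fun L _ => ?_
  rw [Equiv.ofBijective_apply]
  exact_mod_cast congrArg Units.val (prod_sign_rowPerm_exchange L)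

theorem detPowCoeff_eq_sum_latinSquare :
    Matrix.detPowCoeff n =
      ((∑ L : LatinSquare n, ∏ k, (Equiv.Perm.sign (L.rowPerm k) : ℤ) : ℤ) : ℂ) := by
  classical
  rw [Matrix.detPowCoeff_eq_sum]
  push_cast
  symm
  refine Finset.sum_nbij (fun L => L.rowPerm) (fun L _ => ?_) (fun L _ M _ h => ?_)
    (fun σ hσ => ?_) fun L _ => rfl
  · exact Finset.mem_filter.2 ⟨Finset.mem_univ _, L.col_bijective⟩
  · ext i j : 3
    exact congrFun (congrArg DFunLike.coe (congrFun h i)) j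
  · refine ⟨⟨fun i j => σ i j, fun i => (σ i).bijective, (Finset.mem_filter.1 hσ).2⟩, by simp, ?_⟩
    funext i
    ext1 j
    rfl

end LatinSquare

theorem alonTarsi_iff_sum_sign_ne_zero {n : ℕ} :
    AlonTarsi n ↔ ∑ L : LatinSquare n, (L.sign : ℤ) ≠ 0 := by
  classical
  have h : ∑ L : LatinSquare n, (L.sign : ℤ) =
      (Nat.card {L : LatinSquare n // L.sign = 1} : ℤ) -
        Nat.card {L : LatinSquare n // L.sign = -1} := by
    rw [Nat.card_eq_fintype_card, Nat.card_eq_fintype_card, Fintype.card_subtype,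
      Fintype.card_subtype, Finset.card_filter, Finset.card_filter]
    push_cast
    rw [← Finset.sum_sub_distrib]
    refine Finset.sum_congr rfl fun L _ => ?_
    rcases Int.units_eq_one_or L.sign with h | h <;> rw [h] <;> decide
  rw [h, AlonTarsi, sub_ne_zero, ne_comm]
  exact not_congr Nat.cast_inj.symm

theorem alonTarsi_iff_detPowCoeff_ne_zero {n : ℕ} :
    AlonTarsi n ↔ Matrix.detPowCoeff n ≠ 0 := by
  rw [LatinSquare.detPowCoeff_eq_sum_latinSquare, LatinSquare.sum_prod_sign_rowPerm,
    alonTarsi_iff_sum_sign_ne_zero, Int.cast_ne_zero]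
  simp

/-! ### The Schur module of a square diagram -/

namespace YoungDiagram

section permAct

variable (μ : YoungDiagram) {V : Type*} [AddCommGroup V] [Module ℂ V]

theorem permAct_tprod (σ : Equiv.Perm μ.cells) (x : μ.cells → V) :
    μ.permAct V σ (PiTensorProduct.tprod ℂ x) = PiTensorProduct.tprod ℂ fun c => x (σ.symm c) :=
  PiTensorProduct.reindex_tprod (R := ℂ) (s := fun _ : μ.cells => V) σ x

theorem permAct_permAct (σ τ : Equiv.Perm μ.cells) (t : μ.TensorPow V) :
    μ.permAct V σ (μ.permAct V τ t) = μ.permAct V (σ * τ) t := by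
  have h : μ.permAct V σ ∘ₗ μ.permAct V τ = μ.permAct V (σ * τ) := by
    ext x
    simp only [LinearMap.compMultilinearMap_apply, LinearMap.comp_apply, permAct_tprod]
    rfl
  exact LinearMap.congr_fun h t

/-- Right translation by σ permutes the column stabilizer and multiplies each sign by that of σ. -/
theorem colAntisymmetrizer_permAct {σ : Equiv.Perm μ.cells} (hσ : σ ∈ μ.colStabilizer)
    (t : μ.TensorPow V) :
    μ.colAntisymmetrizer V (μ.permAct V σ t) =
      ((Equiv.Perm.sign σ : ℤ) : ℂ) • μ.colAntisymmetrizer V t := by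
  classical
  simp only [colAntisymmetrizer, LinearMap.sum_apply, LinearMap.smul_apply, permAct_permAct,
    Finset.smul_sum, smul_smul]
  refine Finset.sum_equiv (Equiv.mulRight σ) (fun τ => ?_) fun τ _ => ?_
  · simp only [Finset.mem_filter, Finset.mem_univ, true_and, Equiv.coe_mulRight]
    refine ⟨fun h c => (h _).trans (hσ c), fun h c => ?_⟩
    have h1 := h (σ.symm c)
    have h2 := hσ (σ.symm c)
    simp only [Equiv.Perm.mul_apply, Equiv.apply_symm_apply] at h1 h2
    rw [h1, h2]
  · simp only [Equiv.coe_mulRight, Equiv.Perm.sign_mul]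
    congr 1
    rcases Int.units_eq_one_or (Equiv.Perm.sign σ) with h | h <;> simp [h]

end permAct

variable {n : ℕ}

/-- The boxes of the square diagram. -/
def squareEquiv (n : ℕ) : Fin n × Fin n ≃ (rectangle n n).cells where
  toFun p := ⟨(p.1, p.2), by simp [rectangle]⟩
  invFun c := (⟨c.1.1, by have := c.2; simp only [rectangle, Finset.mem_product,
    Finset.mem_range] at this; exact this.1⟩, ⟨c.1.2, by
      have := c.2; simp only [rectangle, Finset.mem_product, Finset.mem_range] at this
      exact this.2⟩)
  left_inv _ := rfl
  right_inv _ := rfl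

/-- The permutation of the boxes of the square that permutes the `j`-th column by `σ j`. -/
def columnPerm (σ : Fin n → Equiv.Perm (Fin n)) : Equiv.Perm (rectangle n n).cells :=
  (squareEquiv n).permCongr (Equiv.prodCongrLeft σ)

theorem columnPerm_squareEquiv (σ : Fin n → Equiv.Perm (Fin n)) (i j : Fin n) :
    columnPerm σ (squareEquiv n (i, j)) = squareEquiv n (σ j i, j) := rfl

theorem sign_columnPerm (σ : Fin n → Equiv.Perm (Fin n)) :
    Equiv.Perm.sign (columnPerm σ) = ∏ j, Equiv.Perm.sign (σ j) := by
  rw [columnPerm, Equiv.Perm.sign_permCongr, Equiv.Perm.sign_prodCongrLeft]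

theorem columnPerm_mem (σ : Fin n → Equiv.Perm (Fin n)) :
    columnPerm σ ∈ (rectangle n n).colStabilizer := fun _ => rfl

theorem columnPerm_injective : Function.Injective (columnPerm (n := n)) := by
  intro σ τ h
  funext j
  ext1 i
  have := congrFun (congrArg DFunLike.coe h) (squareEquiv n (i, j))
  rw [columnPerm_squareEquiv, columnPerm_squareEquiv] at this
  exact congrArg Prod.fst ((squareEquiv n).injective this)

theorem exists_columnPerm_eq {τ : Equiv.Perm (rectangle n n).cells}
    (hτ : τ ∈ (rectangle n n).colStabilizer) : ∃ σ, columnPerm σ = τ := by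
  have h : ∀ i j, τ (squareEquiv n (i, j)) =
      squareEquiv n (((squareEquiv n).symm (τ (squareEquiv n (i, j)))).1, j) := fun i j => by
    apply (squareEquiv n).symm.injective
    rw [Equiv.symm_apply_apply]
    exact Prod.ext rfl (Fin.ext (hτ (squareEquiv n (i, j))))
  refine ⟨fun j => Equiv.ofBijective
    (fun i => ((squareEquiv n).symm (τ (squareEquiv n (i, j)))).1)
    (Function.Injective.bijective_of_finite fun i i' hi => ?_), ?_⟩
  · have h1 := h i j
    rw [hi, ← h i' j] at h1
    exact congrArg Prod.fst ((squareEquiv n).injective (τ.injective h1))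
  · ext1 c
    obtain ⟨⟨i, j⟩, rfl⟩ := (squareEquiv n).surjective c
    rw [h, columnPerm_squareEquiv]
    rfl

variable {V : Type*} [AddCommGroup V] [Module ℂ V] (b : Module.Basis (Fin n) ℂ V)

/-- The pure tensor with the `i`-th basis vector in all boxes of the `i`-th row. -/
noncomputable def rowTensor : (rectangle n n).TensorPow V :=
  PiTensorProduct.tprod ℂ fun c => b ((squareEquiv n).symm c).1

/-- The linear form reading off the coefficient of `rowTensor`. -/
noncomputable def rowTensorCoord : (rectangle n n).TensorPow V →ₗ[ℂ] ℂ :=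
  PiTensorProduct.lift ((MultilinearMap.mkPiAlgebra ℂ (rectangle n n).cells ℂ).compLinearMap
    fun c => b.coord ((squareEquiv n).symm c).1)

theorem rowTensorCoord_tprod (x : (rectangle n n).cells → V) :
    rowTensorCoord b (PiTensorProduct.tprod ℂ x) =
      ∏ c, b.coord ((squareEquiv n).symm c).1 (x c) := by
  simp [rowTensorCoord]

theorem rowTensorCoord_permAct {σ : Equiv.Perm (rectangle n n).cells}
    (hσ : σ ∈ (rectangle n n).rowStabilizer) (t : (rectangle n n).TensorPow V) :
    rowTensorCoord b ((rectangle n n).permAct V σ t) = rowTensorCoord b t := by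
  have h : rowTensorCoord b ∘ₗ (rectangle n n).permAct V σ = rowTensorCoord b := by
    ext x
    simp only [LinearMap.compMultilinearMap_apply, LinearMap.comp_apply, permAct_tprod,
      rowTensorCoord_tprod]
    rw [← Equiv.prod_comp σ]
    refine Finset.prod_congr rfl fun c _ => ?_
    rw [Equiv.symm_apply_apply]
    have h1 : ((squareEquiv n).symm (σ c)).1 = ((squareEquiv n).symm c).1 := Fin.ext (hσ c)
    rw [h1]
  exact LinearMap.congr_fun h t

/-- The form is constant along rows, hence invariant under row permutations; r is the number of
these. This shows that row symmetrization does not kill the antisymmetrized tensor. -/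
theorem exists_rowTensorCoord_rowSymmetrizer :
    ∃ r : ℂ, r ≠ 0 ∧ ∀ t : (rectangle n n).TensorPow V,
      rowTensorCoord b ((rectangle n n).rowSymmetrizer V t) = r * rowTensorCoord b t := by
  classical
  refine ⟨((Finset.univ.filter fun σ : Equiv.Perm (rectangle n n).cells =>
    σ ∈ (rectangle n n).rowStabilizer).card : ℂ), ?_, fun t => ?_⟩
  · rw [Nat.cast_ne_zero, ← Nat.pos_iff_ne_zero, Finset.card_pos]
    exact ⟨1, Finset.mem_filter.2 ⟨Finset.mem_univ _, fun _ => rfl⟩⟩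
  · rw [rowSymmetrizer, LinearMap.sum_apply, map_sum, Finset.sum_congr rfl fun σ hσ =>
      rowTensorCoord_permAct b (Finset.mem_filter.1 hσ).2 t, Finset.sum_const, nsmul_eq_mul]

theorem rowTensorCoord_colAntisymmetrizer (x : (rectangle n n).cells → V) :
    rowTensorCoord b ((rectangle n n).colAntisymmetrizer V (PiTensorProduct.tprod ℂ x)) =
      ∏ j, (Matrix.of fun i i' => b.coord i' (x (squareEquiv n (i, j)))).det := by
  classical
  have h : ∀ j, (Matrix.of fun i i' => b.coord i' (x (squareEquiv n (i, j)))).det =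
      ∑ σ : Equiv.Perm (Fin n), ((Equiv.Perm.sign σ : ℤ) : ℂ) *
        ∏ i, b.coord i (x (squareEquiv n (σ.symm i, j))) := fun j => by
    rw [Matrix.det_apply', ← Equiv.sum_comp (Equiv.inv _)]
    refine Finset.sum_congr rfl fun σ _ => ?_
    simp only [Equiv.inv_apply, Equiv.Perm.sign_inv, Matrix.of_apply]
    rfl
  simp only [h]
  rw [Finset.prod_univ_sum, Fintype.piFinset_univ, colAntisymmetrizer, LinearMap.sum_apply,
    map_sum]
  symm
  refine Finset.sum_nbij columnPerm
    (fun σ _ => Finset.mem_filter.2 ⟨Finset.mem_univ _, columnPerm_mem σ⟩)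
    columnPerm_injective.injOn (fun τ hτ => ?_) fun σ _ => ?_
  · obtain ⟨σ, rfl⟩ := exists_columnPerm_eq (Finset.mem_filter.1 hτ).2
    exact ⟨σ, by simp, rfl⟩
  · rw [LinearMap.smul_apply, map_smul, permAct_tprod, rowTensorCoord_tprod, smul_eq_mul,
      sign_columnPerm, Finset.prod_mul_distrib]
    push_cast
    congr 1
    rw [← (squareEquiv n).prod_comp, Fintype.prod_prod_type_right]
    rfl

/-- On basis tensors: if every column has distinct labels, a column permutation carries the tensor
to `rowTensor b`; if a label repeats in a column, the transposition of the two boxes shows that the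
image equals its own negative. -/
theorem colAntisymmetrizer_eq_smul (t : (rectangle n n).TensorPow V) :
    ∃ c : ℂ, (rectangle n n).colAntisymmetrizer V t =
      c • (rectangle n n).colAntisymmetrizer V (rowTensor b) := by
  classical
  suffices h : LinearMap.range ((rectangle n n).colAntisymmetrizer V) ≤
      Submodule.span ℂ {(rectangle n n).colAntisymmetrizer V (rowTensor b)} by
    obtain ⟨c, hc⟩ := Submodule.mem_span_singleton.1 (h ⟨t, rfl⟩)
    exact ⟨c, hc.symm⟩
  rw [LinearMap.range_eq_map, ← (Basis.piTensorProduct fun _ : (rectangle n n).cells => b).span_eq,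
    Submodule.map_span_le]
  rintro _ ⟨p, rfl⟩
  rw [Basis.piTensorProduct_apply, Submodule.mem_span_singleton]
  by_cases hp : ∀ j, Function.Injective fun i => p (squareEquiv n (i, j))
  · set σ := columnPerm fun j => Equiv.ofBijective _ (hp j).bijective_of_finite
    have hσ : σ ∈ (rectangle n n).colStabilizer := columnPerm_mem _
    have h1 : (rectangle n n).permAct V σ (PiTensorProduct.tprod ℂ fun c => b (p c)) =
        rowTensor b := by
      rw [permAct_tprod, rowTensor]
      congr 1
      funext c
      obtain ⟨c, rfl⟩ := σ.surjective c
      rw [Equiv.symm_apply_apply]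
      rfl
    refine ⟨((Equiv.Perm.sign σ : ℤ) : ℂ), ?_⟩
    rw [← h1, colAntisymmetrizer_permAct _ hσ, smul_smul]
    rcases Int.units_eq_one_or (Equiv.Perm.sign σ) with h | h <;> simp [h]
  · refine ⟨0, ?_⟩
    simp only [Function.Injective, not_forall] at hp
    obtain ⟨j, i, i', hpi, hne⟩ := hp
    have hne' : squareEquiv n (i, j) ≠ squareEquiv n (i', j) := fun h =>
      hne (congrArg Prod.fst ((squareEquiv n).injective h))
    set σ := Equiv.swap (squareEquiv n (i, j)) (squareEquiv n (i', j))
    have hσ : σ ∈ (rectangle n n).colStabilizer := fun c => by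
      by_cases h1 : c = squareEquiv n (i, j)
      · rw [h1, Equiv.swap_apply_left]; rfl
      · by_cases h2 : c = squareEquiv n (i', j)
        · rw [h2, Equiv.swap_apply_right]; rfl
        · rw [Equiv.swap_apply_of_ne_of_ne h1 h2]
    have h1 : (rectangle n n).permAct V σ (PiTensorProduct.tprod ℂ fun c => b (p c)) =
        PiTensorProduct.tprod ℂ fun c => b (p c) := by
      rw [permAct_tprod]
      congr 1
      funext c
      rw [Equiv.symm_swap]
      by_cases h1 : c = squareEquiv n (i, j)
      · rw [h1, Equiv.swap_apply_left]; exact congrArg b hpi.symm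
      · by_cases h2 : c = squareEquiv n (i', j)
        · rw [h2, Equiv.swap_apply_right]; exact congrArg b hpi
        · rw [Equiv.swap_apply_of_ne_of_ne h1 h2]
    have h2 := colAntisymmetrizer_permAct _ hσ (PiTensorProduct.tprod ℂ fun c => b (p c))
    rw [h1, Equiv.Perm.sign_swap hne'] at h2
    simp only [Units.val_neg, Units.val_one, Int.cast_neg, Int.cast_one, neg_smul, one_smul] at h2
    rw [zero_smul]
    have h3 : (2 : ℂ) • (rectangle n n).colAntisymmetrizer V
        (PiTensorProduct.tprod ℂ fun c => b (p c)) = 0 := by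
      rw [two_smul]
      nth_rewrite 1 [h2]
      exact neg_add_cancel _
    exact ((smul_eq_zero.1 h3).resolve_left two_ne_zero).symm

/-- The Schur module of the `n × n` square for an `n`-dimensional space is one-dimensional, and the
group acts on it by the `n`-th power of the determinant. -/
theorem schurModule_square (b : Module.Basis (Fin n) ℂ V)
    {G : Type*} [Group G] (ρ : Representation ℂ G V) :
    ∃ (s : (rectangle n n).schurModule V) (φ : (rectangle n n).schurModule V →ₗ[ℂ] ℂ),
      φ s = 1 ∧ (∀ x, x = φ x • s) ∧
        ∀ g, (rectangle n n).schurRep ρ g s = LinearMap.det (ρ g) ^ n • s := by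
  set ω := (rectangle n n).colAntisymmetrizer V (rowTensor b) with hω
  have hone : rowTensorCoord b ω = 1 := by
    rw [hω, rowTensor, rowTensorCoord_colAntisymmetrizer]
    refine Finset.prod_eq_one fun j _ => ?_
    rw [← Matrix.det_one (n := Fin n) (R := ℂ)]
    congr 1
    ext i i'
    simp [Matrix.one_apply, Finsupp.single_apply]
  obtain ⟨r, hr, hrow⟩ := exists_rowTensorCoord_rowSymmetrizer b
  set s : (rectangle n n).schurModule V :=
    ⟨(rectangle n n).rowSymmetrizer V ω, ⟨rowTensor b, rfl⟩⟩ with hs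
  set φ : (rectangle n n).schurModule V →ₗ[ℂ] ℂ :=
    r⁻¹ • (rowTensorCoord b ∘ₗ ((rectangle n n).schurModule V).subtype) with hφ
  have hφs : φ s = 1 := by
    simp [hφ, hs, hrow, hone, hr]
  have hspan : ∀ x, x = φ x • s := by
    rintro ⟨_, t, rfl⟩
    obtain ⟨c, hc⟩ := colAntisymmetrizer_eq_smul b t
    have h1 : (⟨(rectangle n n).youngSymmetrizer V t, ⟨t, rfl⟩⟩ :
        (rectangle n n).schurModule V) = c • s := by
      apply Subtype.ext
      simp only [youngSymmetrizer, LinearMap.comp_apply, hc, map_smul, hs]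
      rfl
    rw [h1, map_smul, hφs, smul_eq_mul, mul_one]
  refine ⟨s, φ, hφs, hspan, fun g => ?_⟩
  have h2 : (((rectangle n n).schurRep ρ g s : (rectangle n n).schurModule V) :
      (rectangle n n).TensorPow V) = (rectangle n n).rowSymmetrizer V
        ((rectangle n n).colAntisymmetrizer V
          ((rectangle n n).tensorRep ρ g (rowTensor b))) :=
    (rectangle n n).tensorRep_youngSymmetrizer ρ g (rowTensor b)
  have h3 : φ ((rectangle n n).schurRep ρ g s) = LinearMap.det (ρ g) ^ n := by
    simp only [hφ, LinearMap.smul_apply, LinearMap.comp_apply, Submodule.subtype_apply, h2, hrow,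
      smul_eq_mul, inv_mul_cancel_left₀ hr]
    have h4 : (rectangle n n).tensorRep ρ g (rowTensor b) =
        PiTensorProduct.tprod ℂ fun c => ρ g (b ((squareEquiv n).symm c).1) :=
      PiTensorProduct.map_tprod _ _
    rw [h4, rowTensorCoord_colAntisymmetrizer]
    have h5 : ∀ j : Fin n, (Matrix.of fun i i' => b.coord i' (ρ g
        (b ((squareEquiv n).symm (squareEquiv n (i, j))).1))).det = LinearMap.det (ρ g) := by
      intro j
      rw [← LinearMap.det_toMatrix b, ← Matrix.det_transpose]
      congr 1
      ext i i'
      simp [LinearMap.toMatrix_apply]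
    rw [Finset.prod_congr rfl fun j _ => h5 j]
    simp
  rw [hspan ((rectangle n n).schurRep ρ g s), h3]

end YoungDiagram

/-! ### Kumar's conjecture as the existence of a semi-invariant -/

theorem det_dual_stdRep {n : ℕ} (g : GL (Fin n) ℂ) :
    LinearMap.det ((stdRep n).dual g) = (g⁻¹ : GL (Fin n) ℂ).1.det := by
  rw [Representation.dual_apply, ← LinearMap.det_toLin']
  exact LinearMap.det_dualMap _

/-- Kumar's conjecture for the square diagram, in terms of a semi-invariant regular function on the
Chow variety. -/
theorem kumarConjecture_iff_exists_semiinvariant {n : ℕ} :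
    KumarConjecture n n ↔ ∃ f ∈ Chow.coordRing n n, f ≠ 0 ∧
      ∀ g : GL (Fin n) ℂ, Chow.functionRep n n g f = (g⁻¹ : GL (Fin n) ℂ).1.det ^ n • f := by
  obtain ⟨s, φ, hφs, hspan, hact⟩ := YoungDiagram.schurModule_square
    (Pi.basisFun ℂ (Fin n)).dualBasis (stdRep n).dual
  have hs : s ≠ 0 := by
    rintro rfl
    simp at hφs
  simp only [det_dual_stdRep] at hact
  constructor
  · rintro ⟨T, hT⟩
    refine ⟨T s, (T s).2, fun h => hs (hT ?_), fun g => ?_⟩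
    · rw [show T s = 0 from Subtype.ext h]
      exact (map_zero T.toLinearMap).symm
    · have h := Representation.IntertwiningMap.isIntertwining _ _ T g s
      rw [hact] at h
      have h1 : T ((g⁻¹ : GL (Fin n) ℂ).1.det ^ n • s) = (g⁻¹ : GL (Fin n) ℂ).1.det ^ n • T s :=
        map_smul T.toLinearMap _ _
      rw [h1] at h
      exact (congrArg Subtype.val h).symm
  · rintro ⟨f, hf, hf0, hg⟩
    set F : Subalgebra.toSubmodule (Chow.coordRing n n) := ⟨f, hf⟩
    have hF : F ≠ 0 := fun h => hf0 (congrArg Subtype.val h)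
    refine ⟨LinearMap.intertwiningMap_of_isIntertwiningMap _ _ (φ.smulRight F) fun g v => ?_, ?_⟩
    · have hgF : Chow.coordRep n n g F = (g⁻¹ : GL (Fin n) ℂ).1.det ^ n • F :=
        Subtype.ext (hg g)
      rw [hspan v]
      simp only [map_smul, hact, LinearMap.smulRight_apply, hφs, hgF,
        smul_smul, one_smul]
    · intro x y hxy
      have h1 : φ x • F = φ y • F := hxy
      rw [hspan x, hspan y, smul_left_injective ℂ hF h1]

/-! ### Semi-invariant functions on the Chow variety and integrals over `SU(n)` -/

namespace Chow

open MvPolynomial Matrix MeasureTheory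

section coordRing

variable {m d : ℕ}

theorem isHomogeneous_prod_vec (w : Fin d → Fin m → ℂ) : (∏ k, vec (w k)).IsHomogeneous d := by
  have h := IsHomogeneous.prod Finset.univ (fun k => vec (w k)) (fun _ => 1) fun k _ =>
    IsHomogeneous.sum _ _ _ fun i _ => isHomogeneous_C_mul_X _ i
  simpa using h

/-- The point `w_1 ⋯ w_d` of the cone over the Chow variety. -/
noncomputable def point (w : Fin d → Fin m → ℂ) : cone m d :=
  ⟨⟨∏ k, vec (w k), isHomogeneous_prod_vec w⟩, w, rfl⟩

theorem coe_point (w : Fin d → Fin m → ℂ) :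
    ((point w : SymPow m d) : MvPolynomial (Fin m) ℂ) = ∏ k, vec (w k) := rfl

theorem exists_point_eq (p : cone m d) : ∃ w, point w = p := by
  obtain ⟨p, w, hw⟩ := p
  exact ⟨w, Subtype.ext (Subtype.ext hw.symm)⟩

theorem functionRep_apply_point (g : GL (Fin m) ℂ) (f : cone m d → ℂ) (w : Fin d → Fin m → ℂ) :
    functionRep m d g f (point w) =
      f (point fun k => (g⁻¹ : GL (Fin m) ℂ).1.mulVec (w k)) := by
  have h : (⟨symRep m d g⁻¹ (point w), symRep_mem_cone g⁻¹ (point w).2⟩ : cone m d) =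
      point fun k => (g⁻¹ : GL (Fin m) ℂ).1.mulVec (w k) := by
    apply Subtype.ext
    apply Subtype.ext
    change symAlgMap (g⁻¹ : GL (Fin m) ℂ).1 (∏ k, vec (w k)) = _
    simp only [map_prod, symAlgMap_vec]
    rfl
  exact congrArg f h

theorem eval_vec (v w : Fin m → ℂ) : eval v (vec w) = ∑ i, w i * v i := by
  simp [vec]

/-- The coordinate ring is generated by the evaluations at vectors of the dual space. -/
theorem coordRing_eq_adjoin_eval :
    coordRing m d = Algebra.adjoin ℂ (Set.range fun (v : Fin m → ℂ) (p : cone m d) =>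
      eval v (p : MvPolynomial (Fin m) ℂ)) := by
  have hfd : FiniteDimensional ℂ (SymPow m d) :=
    Module.Finite.iff_fg.2 (homogeneousSubmodule_fg (Fin m) ℂ d)
  obtain ⟨E, hE⟩ : ∃ E : (Fin m → ℂ) → Module.Dual ℂ (SymPow m d),
      ∀ v p, E v p = eval v (p : MvPolynomial (Fin m) ℂ) :=
    ⟨fun v => (aeval v : MvPolynomial (Fin m) ℂ →ₐ[ℂ] ℂ).toLinearMap ∘ₗ (SymPow m d).subtype,
      fun v p => by simp [aeval_eq_eval]⟩
  -- By finite-dimensional duality it suffices that no nonzero form is killed by all evaluations,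
  -- which holds over an infinite field.
  have hspan : Submodule.span ℂ (Set.range E) = ⊤ := by
    rw [← Subspace.dualCoannihilator_dualAnnihilator_eq
      (W := Submodule.span ℂ (Set.range E)), eq_top_iff]
    intro φ _
    rw [Submodule.mem_dualAnnihilator]
    intro p hp
    rw [Submodule.mem_dualCoannihilator] at hp
    have h0 : p = 0 := by
      apply Subtype.ext
      apply MvPolynomial.funext
      intro v
      rw [← hE, hp _ (Submodule.subset_span ⟨v, rfl⟩)]
      simp
    rw [h0, map_zero]
  apply le_antisymm
  · refine Algebra.adjoin_le ?_
    rintro _ ⟨φ, rfl⟩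
    have hφ : φ ∈ Submodule.span ℂ (Set.range E) := hspan ▸ Submodule.mem_top
    induction hφ using Submodule.span_induction with
    | mem φ hφ =>
      obtain ⟨v, rfl⟩ := hφ
      exact Algebra.subset_adjoin ⟨v, funext fun p => (hE v p).symm⟩
    | zero => exact Subalgebra.zero_mem _
    | add φ ψ _ _ h h' => exact Subalgebra.add_mem _ h h'
    | smul c φ _ h => exact Subalgebra.smul_mem _ h c
  · refine Algebra.adjoin_mono ?_
    rintro _ ⟨v, rfl⟩
    exact ⟨E v, funext fun p => hE v p⟩

theorem coeff_mem_coordRing (α : Fin m →₀ ℕ) :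
    (fun p : cone m d => coeff α (p : MvPolynomial (Fin m) ℂ)) ∈ coordRing m d :=
  Algebra.subset_adjoin ⟨lcoeff ℂ α ∘ₗ (SymPow m d).subtype, rfl⟩

end coordRing

variable {n : ℕ}

/-- The function on the cone obtained by applying a linear form on polynomials in the entries of a
generic matrix to the product of the values at the columns. -/
noncomputable def columnForm (L : MvPolynomial (Fin n × Fin n) ℂ →ₗ[ℂ] ℂ) : cone n n → ℂ :=
  fun p => L (∏ l, aeval (fun i => X (i, l)) (p : MvPolynomial (Fin n) ℂ))

/-- Expanding p into monomials in each of the n factors and applying L termwise gives a polynomial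
of degree n in the coefficients of p. -/
theorem columnForm_mem_coordRing (L : MvPolynomial (Fin n × Fin n) ℂ →ₗ[ℂ] ℂ) :
    columnForm L ∈ coordRing n n := by
  classical
  set A : Finset (Fin n →₀ ℕ) := Finset.univ.finsuppAntidiag n
  have hp : ∀ p : cone n n, (p : MvPolynomial (Fin n) ℂ) =
      ∑ α ∈ A, coeff α (p : MvPolynomial (Fin n) ℂ) • monomial α 1 := by
    intro p
    conv_lhs => rw [MvPolynomial.as_sum (p : MvPolynomial (Fin n) ℂ)]
    refine (Finset.sum_subset (fun α hα => ?_) fun α _ hα => ?_).trans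
      (Finset.sum_congr rfl fun α _ => by rw [smul_monomial, smul_eq_mul, mul_one])
    · have h := (IsHomogeneous.finsuppSum_eq (p : SymPow n n).2 hα)
      rw [Finsupp.sum_fintype _ _ (by simp)] at h
      simpa [A, Finset.mem_finsuppAntidiag] using h
    · rw [notMem_support_iff.1 hα, map_zero]
  have h : columnForm L = ∑ s ∈ Fintype.piFinset fun _ : Fin n => A,
      L (∏ l, aeval (fun i => X (i, l)) (monomial (s l) (1 : ℂ))) •
        ∏ l, fun p : cone n n => coeff (s l) (p : MvPolynomial (Fin n) ℂ) := by
    funext p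
    have h1 : ∀ l : Fin n, aeval (fun i => (X (i, l) : MvPolynomial (Fin n × Fin n) ℂ))
        (p : MvPolynomial (Fin n) ℂ) = ∑ α ∈ A, coeff α (p : MvPolynomial (Fin n) ℂ) •
          aeval (fun i => (X (i, l) : MvPolynomial (Fin n × Fin n) ℂ)) (monomial α (1 : ℂ)) := by
      intro l
      conv_lhs => rw [hp p]
      simp only [map_sum, map_smul]
    simp only [columnForm, h1]
    rw [Finset.prod_univ_sum, map_sum, Finset.sum_apply]
    refine Finset.sum_congr rfl fun s _ => ?_
    rw [Pi.smul_apply, Finset.prod_apply, Finset.prod_smul, map_smul, smul_eq_mul, smul_eq_mul,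
      mul_comm]
  rw [h]
  exact Subalgebra.sum_mem _ fun s _ => Subalgebra.smul_mem _
    (Subalgebra.prod_mem _ fun l _ => coeff_mem_coordRing _) _

/-- The value at `v` of the product of the columns of a generic matrix. -/
noncomputable def columnProduct (v : Fin n → ℂ) : MvPolynomial (Fin n × Fin n) ℂ :=
  ∏ k, ∑ i, C (v i) * X (i, k)

theorem isHomogeneous_columnProduct (v : Fin n → ℂ) : (columnProduct v).IsHomogeneous n := by
  have h := IsHomogeneous.prod Finset.univ
    (fun k => (∑ i, C (v i) * X (i, k) : MvPolynomial (Fin n × Fin n) ℂ)) (fun _ => 1) fun k _ =>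
    IsHomogeneous.sum _ _ _ fun i _ => isHomogeneous_C_mul_X _ _
  simpa [columnProduct] using h

theorem eval_point_transpose (A : Matrix (Fin n) (Fin n) ℂ) (v : Fin n → ℂ) :
    eval v ((point fun k => Aᵀ k : SymPow n n) : MvPolynomial (Fin n) ℂ) =
      evalMatrix A (columnProduct v) := by
  rw [coe_point, map_prod, columnProduct, map_prod]
  refine Finset.prod_congr rfl fun k _ => ?_
  rw [eval_vec, map_sum]
  refine Finset.sum_congr rfl fun i _ => ?_
  rw [map_mul, evalMatrix_C, evalMatrix_X, mul_comm]
  rfl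

theorem exists_prod_eq_prod_fin {σ : Type*} {α : σ →₀ ℕ} (hα : (α.sum fun _ k => k) = n) :
    ∃ v : Fin n → σ, ∀ G : σ → MvPolynomial (Fin n × Fin n) ℂ,
      (α.prod fun s k => G s ^ k) = ∏ l, G (v l) := by
  classical
  obtain ⟨l, hl⟩ := Quot.exists_rep (Finsupp.toMultiset α)
  have hl' : (l : Multiset σ) = Finsupp.toMultiset α := hl
  have hlen : l.length = n := by
    rw [← Multiset.coe_card, hl', Finsupp.card_toMultiset]
    exact hα
  subst hlen
  refine ⟨l.get, fun G => ?_⟩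
  have h1 : (α.prod fun s k => G s ^ k) = ((Finsupp.toMultiset α).map G).prod := by
    rw [Finset.prod_multiset_map_count, Finsupp.toFinset_toMultiset]
    simp [Finsupp.prod, Finsupp.count_toMultiset]
  rw [h1, ← hl', Multiset.map_coe, Multiset.prod_coe, ← List.prod_ofFn]
  congr 1
  simp [List.ofFn_getElem_eq_map]

variable [MeasurableSpace (specialUnitaryGroup (Fin n) ℂ)]
  [BorelSpace (specialUnitaryGroup (Fin n) ℂ)]
  (μ : Measure (specialUnitaryGroup (Fin n) ℂ)) [μ.IsHaarMeasure]

/-- At w_1⋯w_n the integrand is ∏ (wg)_kl, where w has rows w_k. -/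
theorem columnForm_point (w : Fin n → Fin n → ℂ) :
    columnForm (specialUnitaryIntegral μ) (point w) =
      (∫ g : specialUnitaryGroup (Fin n) ℂ, ∏ i, ∏ j, (g : Matrix (Fin n) (Fin n) ℂ) i j ∂μ) *
        (Matrix.of w).det ^ n := by
  rw [← integral_prod_mul_eq, columnForm, specialUnitaryIntegral_apply]
  refine integral_congr_ae (Filter.Eventually.of_forall fun g => ?_)
  simp only [coe_point, map_prod]
  rw [Finset.prod_comm]
  refine Finset.prod_congr rfl fun k _ => Finset.prod_congr rfl fun l _ => ?_
  simp [vec, mul_apply, map_sum]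

theorem kumarConjecture_of_integral_ne_zero
    (h : (∫ g : specialUnitaryGroup (Fin n) ℂ,
      ∏ i, ∏ j, (g : Matrix (Fin n) (Fin n) ℂ) i j ∂μ) ≠ 0) : KumarConjecture n n := by
  rw [kumarConjecture_iff_exists_semiinvariant]
  refine ⟨columnForm (specialUnitaryIntegral μ), columnForm_mem_coordRing _, fun h0 => h ?_,
    fun g => ?_⟩
  · have h1 := columnForm_point μ (1 : Matrix (Fin n) (Fin n) ℂ)
    have h2 : (Matrix.of (1 : Matrix (Fin n) (Fin n) ℂ)).det = 1 := Matrix.det_one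
    rw [h0, h2, one_pow, mul_one] at h1
    exact h1.symm
  · funext p
    obtain ⟨w, rfl⟩ := exists_point_eq p
    rw [functionRep_apply_point, Pi.smul_apply, columnForm_point, columnForm_point, smul_eq_mul]
    have h1 : (Matrix.of fun k => (g⁻¹ : GL (Fin n) ℂ).1.mulVec (w k)) =
        Matrix.of w * (g⁻¹ : GL (Fin n) ℂ).1ᵀ := by
      ext k i
      simp [mul_apply, mulVec, dotProduct, mul_comm]
    rw [h1, det_mul, det_transpose]
    ring

theorem specialUnitaryIntegral_prod_columnProduct (v : Fin n → Fin n → ℂ) :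
    specialUnitaryIntegral μ (∏ l, columnProduct (v l)) =
      (∫ g : specialUnitaryGroup (Fin n) ℂ, ∏ i, ∏ j, (g : Matrix (Fin n) (Fin n) ℂ) i j ∂μ) *
        (Matrix.of v).det ^ n := by
  rw [← integral_prod_mul_eq, specialUnitaryIntegral_apply]
  refine integral_congr_ae (Filter.Eventually.of_forall fun g => ?_)
  simp [columnProduct, map_prod, mul_apply, map_sum]

theorem integral_ne_zero_of_kumarConjecture (h : KumarConjecture n n) :
    (∫ g : specialUnitaryGroup (Fin n) ℂ,
      ∏ i, ∏ j, (g : Matrix (Fin n) (Fin n) ℂ) i j ∂μ) ≠ 0 := by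
  intro hI
  -- For n = 0 the product is empty and the integral is the total mass. Positivity of n is needed
  -- below to recover the number of evaluations from the degree.
  rcases Nat.eq_zero_or_pos n with rfl | hn
  · refine specialUnitaryIntegral_det_pow_ne_zero μ 0 ?_
    rw [← hI, specialUnitaryIntegral_apply]
    simp
  rw [kumarConjecture_iff_exists_semiinvariant] at h
  obtain ⟨f, hf, hf0, hact⟩ := h
  rw [coordRing_eq_adjoin_eval, Algebra.adjoin_range_eq_range_aeval] at hf
  obtain ⟨P, hP⟩ := hf
  set Q : MvPolynomial (Fin n × Fin n) ℂ := aeval columnProduct P with hQ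
  have hfQ : ∀ A : Matrix (Fin n) (Fin n) ℂ, f (point fun k => Aᵀ k) = evalMatrix A Q := by
    intro A
    have h1 : ((Pi.evalRingHom (fun _ : cone n n => ℂ) (point fun k => Aᵀ k)).comp
        (aeval (R := ℂ) (fun (v : Fin n → ℂ) (p : cone n n) =>
          eval v (p : MvPolynomial (Fin n) ℂ))).toRingHom) =
        (evalMatrix A).comp (aeval columnProduct : _ →ₐ[ℂ] _).toRingHom := by
      refine MvPolynomial.ringHom_ext (fun r => ?_) fun v => ?_
      · simp [MvPolynomial.algebraMap_eq]
      · simpa using eval_point_transpose A v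
    rw [← hP]
    exact RingHom.congr_fun h1 P
  obtain ⟨c, hc⟩ : ∃ c, f (point fun k => (1 : Matrix (Fin n) (Fin n) ℂ)ᵀ k) = c := ⟨_, rfl⟩
  -- Semi-invariance moves the point e_1⋯e_n to the product of the columns of a unitary u, so Q =
  -- c·det^n on U(n), hence everywhere.
  have hQdet : Q = C c * (mvPolynomialX (Fin n) (Fin n) ℂ).det ^ n := by
    rw [← sub_eq_zero]
    refine eq_zero_of_evalMatrix_unitary_eq_zero fun U hU => ?_
    have hUu : IsUnit U := ⟨⟨U, star U, mem_unitaryGroup_iff.1 hU, mem_unitaryGroup_iff'.1 hU⟩, rfl⟩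
    obtain ⟨u, rfl⟩ := hUu
    have h1 := congrFun (hact u⁻¹) (point fun k => (1 : Matrix (Fin n) (Fin n) ℂ)ᵀ k)
    rw [functionRep_apply_point, inv_inv, Pi.smul_apply, smul_eq_mul, hc] at h1
    have h2 : (fun k => (u : Matrix (Fin n) (Fin n) ℂ).mulVec
        ((1 : Matrix (Fin n) (Fin n) ℂ)ᵀ k)) = fun k => (u : Matrix (Fin n) (Fin n) ℂ)ᵀ k := by
      funext k i
      simp [mulVec, dotProduct, Matrix.one_apply]
    rw [h2, hfQ] at h1
    rw [map_sub, map_mul, map_pow, evalMatrix_C, evalMatrix_det, h1]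
    ring
  have hterm : ∀ α : (Fin n → ℂ) →₀ ℕ, (α.sum fun _ k => k) = n →
      specialUnitaryIntegral μ (α.prod fun v k => columnProduct v ^ k) = 0 := by
    intro α hα
    obtain ⟨v, hv⟩ := exists_prod_eq_prod_fin hα
    rw [hv, specialUnitaryIntegral_prod_columnProduct, hI, zero_mul]
  have hLQ : specialUnitaryIntegral μ Q = 0 := by
    -- P need not be homogeneous. A product of k evaluations has degree nk in the matrix entries, so
    -- projecting to degree n² keeps only the terms with k = n, to which `hterm` applies.
    have h1 : homogeneousComponent (n * n) Q = Q := by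
      have : Q.IsHomogeneous (n * n) := by
        rw [hQdet]
        have := (isHomogeneous_C (Fin n × Fin n) c).mul
          ((isHomogeneous_det_mvPolynomialX (n := n)).pow n)
        rwa [zero_add] at this
      rw [homogeneousComponent_of_mem this, if_pos rfl]
    have h2 : Q = ∑ α ∈ P.support, coeff α P • α.prod fun v k => columnProduct v ^ k := by
      rw [hQ, aeval_def, eval₂_eq]
      refine Finset.sum_congr rfl fun α _ => ?_
      rw [Algebra.smul_def]
      rfl
    rw [← h1, h2, map_sum, map_sum]
    refine Finset.sum_eq_zero fun α _ => ?_
    rw [map_smul, map_smul]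
    have h3 : (α.prod fun v k => columnProduct v ^ k).IsHomogeneous
        (n * (α.sum fun _ k => k)) := by
      rw [Finsupp.sum, Finset.mul_sum]
      exact IsHomogeneous.prod _ _ _ fun v _ => (isHomogeneous_columnProduct v).pow _
    rw [homogeneousComponent_of_mem h3]
    split_ifs with hdeg
    · rw [hterm α (Nat.eq_of_mul_eq_mul_left hn hdeg.symm), smul_zero]
    · rw [map_zero, smul_zero]
  have hc0 : c = 0 := by
    rw [hQdet, ← smul_eq_C_mul, map_smul, smul_eq_mul] at hLQ
    exact (mul_eq_zero.1 hLQ).resolve_right (specialUnitaryIntegral_det_pow_ne_zero μ n)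
  refine hf0 (funext fun p => ?_)
  obtain ⟨w, rfl⟩ := exists_point_eq p
  have h1 := hfQ (Matrix.of w)ᵀ
  rw [hQdet, hc0, C_0, zero_mul, map_zero] at h1
  exact h1

end Chow

open MvPolynomial MeasureTheory Matrix in
theorem mainTheorem1 (n : ℕ) (hn : Even n)
    [MeasurableSpace (specialUnitaryGroup (Fin n) ℂ)] [BorelSpace (specialUnitaryGroup (Fin n) ℂ)]
    (μ : Measure (specialUnitaryGroup (Fin n) ℂ)) [μ.IsHaarMeasure] :
    [ AlonTarsi n,
      KumarConjecture n n,
      (∫ g : specialUnitaryGroup (Fin n) ℂ,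
        permanent (g : Matrix (Fin n) (Fin n) ℂ) ^ n ∂μ) ≠ 0,
      polarPairing (permanent (mvPolynomialX (Fin n) (Fin n) ℂ) ^ n)
        (det (mvPolynomialX (Fin n) (Fin n) ℂ) ^ n) ≠ 0 ].TFAE ∧
    ((∫ g : specialUnitaryGroup (Fin n) ℂ,
        ∏ i, ∏ j, (g : Matrix (Fin n) (Fin n) ℂ) i j ∂μ) ≠ 0 ↔
      polarPairing (∏ i, ∏ j, mvPolynomialX (Fin n) (Fin n) ℂ i j)
        (det (mvPolynomialX (Fin n) (Fin n) ℂ) ^ n) ≠ 0) ∧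
    ((∫ g : specialUnitaryGroup (Fin n) ℂ,
        ∏ i, ∏ j, (g : Matrix (Fin n) (Fin n) ℂ) i j ∂μ) ≠ 0 →
      AlonTarsi n ∧
      KumarConjecture n n ∧
      (∫ g : specialUnitaryGroup (Fin n) ℂ,
        permanent (g : Matrix (Fin n) (Fin n) ℂ) ^ n ∂μ) ≠ 0 ∧
      polarPairing (permanent (mvPolynomialX (Fin n) (Fin n) ℂ) ^ n)
        (det (mvPolynomialX (Fin n) (Fin n) ℂ) ^ n) ≠ 0) := by
  obtain ⟨c, hc, hpair⟩ := specialUnitaryIntegral_eq_polarPairing μ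
  set I := ∫ g : specialUnitaryGroup (Fin n) ℂ,
    ∏ i, ∏ j, (g : Matrix (Fin n) (Fin n) ℂ) i j ∂μ with hI
  have hIL : I = specialUnitaryIntegral μ (∏ i, ∏ j, mvPolynomialX (Fin n) (Fin n) ℂ i j) := by
    simp [hI, specialUnitaryIntegral_apply, map_prod]
  have hhom : (∏ i, ∏ j, mvPolynomialX (Fin n) (Fin n) ℂ i j).IsHomogeneous (n * n) := by
    have h := IsHomogeneous.prod Finset.univ
      (fun q : Fin n × Fin n => (X q : MvPolynomial (Fin n × Fin n) ℂ)) (fun _ => 1)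
      fun q _ => isHomogeneous_X ℂ q
    simpa [Fintype.prod_prod_type] using h
  have hI_pair := hIL.trans (hpair _ hhom)
  have h_AT : AlonTarsi n ↔ I ≠ 0 := by
    rw [alonTarsi_iff_detPowCoeff_ne_zero, hI_pair, polarPairing_prod_X, detPowCoeff]
    simp [hc]
  have h_kumar : KumarConjecture n n ↔ I ≠ 0 :=
    ⟨Chow.integral_ne_zero_of_kumarConjecture μ, Chow.kumarConjecture_of_integral_ne_zero μ⟩
  have h_perm : (∫ g : specialUnitaryGroup (Fin n) ℂ,
      permanent (g : Matrix (Fin n) (Fin n) ℂ) ^ n ∂μ) ≠ 0 ↔ I ≠ 0 := by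
    -- Both factors, I and `detPowCoeff n`, are nonzero under the same condition.
    rw [integral_permanent_pow, mul_ne_zero_iff, ← alonTarsi_iff_detPowCoeff_ne_zero, h_AT]
    exact and_self_iff
  have h_permPair : polarPairing (permanent (mvPolynomialX (Fin n) (Fin n) ℂ) ^ n)
      (det (mvPolynomialX (Fin n) (Fin n) ℂ) ^ n) ≠ 0 ↔ I ≠ 0 := by
    have h := hpair _ (isHomogeneous_permanent_mvPolynomialX.pow n)
    simp only [specialUnitaryIntegral_apply, map_pow, evalMatrix_permanent] at h
    rw [← h_perm, h, mul_ne_zero_iff]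
    simp [hc]
  have h_prodPair : I ≠ 0 ↔ polarPairing (∏ i, ∏ j, mvPolynomialX (Fin n) (Fin n) ℂ i j)
      (det (mvPolynomialX (Fin n) (Fin n) ℂ) ^ n) ≠ 0 := by
    rw [hI_pair, mul_ne_zero_iff]
    simp [hc]
  refine ⟨?_, h_prodPair, fun h =>
    ⟨h_AT.2 h, h_kumar.2 h, h_perm.2 h, h_permPair.2 h⟩⟩
  tfae_have 1 ↔ 2 := h_AT.trans h_kumar.symm
  tfae_have 1 ↔ 3 := h_AT.trans h_perm.symm
  tfae_have 1 ↔ 4 := h_AT.trans h_permPair.symm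
  tfae_finish
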